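/- Let $\ell_2=\ell_2(\mathbb N)$ over $\mathbb C$. For a Hilbert space $H$ let $H_c=B(\mathbb C,H)$ and $H_r=B(H^*,\mathbb C)$ be the column and row operator spaces on $H$, and put $R=(\ell_2)_r$, $C=(\ell_2)_c$. Direct sums of operator spaces carry the norms $\|(x,y)\|_{M_n(E\oplus F)}=\max\{\|x\|_{M_n(E)},\|y\|_{M_n(F)}\}$, and a quotient carries the quotient norms $M_n(E/N)=M_n(E)/M_n(N)$. $OH$ is the operator space on $\ell_2$ with $\|[x_{ij}]\|_{M_n(OH)}=\big\|[\langle x_{ij},x_{kl}\rangle]\big\|_{M_{n^2}}^{1/2}$ (rows indexed by $(i,k)$ and columns by $(j,l)$); it is the unique operator space structure on $\ell_2$ that is canonically completely isometric to its anti-dual. Let $S=\{z\in\mathbb C: 0<\operatorname{Re}z<1\}$, and let $\mu_0,\mu_1$ be the probability measures $dt/\cosh(\pi t)$ on the lines $\{it\}$ and $\{1+it\}$, $t\in\mathbb R$, so that $\frac12(\mu_0+\mu_1)$ is the harmonic measure of the point $\frac12$ in $S$. Let $E=L_2(\mu_0;\ell_2)_r\oplus L_2(\mu_1;\ell_2)_c$,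 and let $G\subset E$ be the $\ell_2$-valued Hardy space $H^2$ of the strip, viewed as a space of boundary values, i.e. the closure in $E$ of the set of pairs $(f|_{\operatorname{Re}z=0},f|_{\operatorname{Re}z=1})$, where $f:\overline S\to\ell_2$ is bounded, continuous, and holomorphic in $S$. A holomorphic function $f:S\to\ell_2$ is called an analytic extension of $g\in G$ if there are functions $f_k:\overline S\to\ell_2$, bounded, continuous, and holomorphic in $S$, whose boundary values converge to $g$ in $E$ and which converge to $f$ locally uniformly in $S$. Let $N\subset G$ be the subspace of those $g\in G$ that have an analytic extension $f$ with $f(1/2)=0$. Then: (a) $OH$ is completely isometric to a quotient of a subspace of $R\oplus C$: there are a closed subspace $S_0\subset R\oplus C$, a closed subspace $N_0\subset S_0$ and a completely isometric linear isomorphism $S_0/N_0\to OH$. (b) $E$ is completely isometric to $R\oplus C$. (c) Every $g\in G$ has exactly one analytic extension to $S$. (d) There is a completely isometric linear isomorphism $G/N\to OH$ that maps the class of $g\in G$ to $f(1/2)$, where $f$ is the analytic extension of $g$. -/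

import Mathlib

open MeasureTheory Filter Topology

noncomputable section

namespace OpSpace

/-- The Hilbert space `ℓ₂` (indexed by `ℕ`, over `ℂ`). -/
abbrev Ell2 : Type := lp (fun _ : ℕ => ℂ) 2

/-! ### Operator space structures, given by their matrix norms -/

/-- A family of functions `Mₙ(E) → ℝ`, `n ∈ ℕ`, in which the norms of the spaces `Mₙ(E)` of an
operator space `E` are recorded. -/
abbrev MatrixNorms (E : Type*) : Type _ := (n : ℕ) → Matrix (Fin n) (Fin n) E → ℝ

/-- The operator `Xⁿ → Yⁿ` between `ℓ₂`-sums that is defined by a matrix of bounded operators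
`X → Y`: its `i`-th coordinate at `v` is `∑ j, T i j (v j)`. -/
def blockOperator {X Y : Type*} [NormedAddCommGroup X] [NormedSpace ℂ X]
    [NormedAddCommGroup Y] [NormedSpace ℂ Y] {n : ℕ} (T : Matrix (Fin n) (Fin n) (X →L[ℂ] Y)) :
    PiLp 2 (fun _ : Fin n => X) →L[ℂ] PiLp 2 (fun _ : Fin n => Y) :=
  ((PiLp.continuousLinearEquiv 2 ℂ (fun _ : Fin n => Y)).symm :
      (Fin n → Y) →L[ℂ] PiLp 2 (fun _ : Fin n => Y)) ∘L
    ContinuousLinearMap.pi (fun i => ∑ j, (T i j) ∘L (PiLp.proj 2 (fun _ : Fin n => X) j))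

/-- The operator space structure that a linear map `ι : E → B(X, Y)` induces on `E`:
`Mₙ(B(X, Y)) = B(Xⁿ, Yⁿ)`. -/
def inducedNorms {E X Y : Type*} [NormedAddCommGroup X] [NormedSpace ℂ X]
    [NormedAddCommGroup Y] [NormedSpace ℂ Y] (ι : E → (X →L[ℂ] Y)) : MatrixNorms E :=
  fun _ x => ‖blockOperator (x.map ι)‖

/-- The column operator space `H_c = B(ℂ, H)`; here `v ∈ H` is the operator `c ↦ c • v`. -/
def colNorms (H : Type*) [NormedAddCommGroup H] [NormedSpace ℂ H] : MatrixNorms H :=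
  inducedNorms (fun v : H => ContinuousLinearMap.toSpanSingleton ℂ v)

/-- The row operator space `H_r = B(H*, ℂ)`; here `v ∈ H` is the operator `ξ ↦ ξ v`. -/
def rowNorms (H : Type*) [NormedAddCommGroup H] [NormedSpace ℂ H] : MatrixNorms H :=
  inducedNorms (fun v : H => NormedSpace.inclusionInDoubleDual ℂ H v)

/-- The direct sum `E ⊕ F` of operator spaces (block diagonal operators): the norm of `Mₙ(E ⊕ F)`
is the maximum of the norms of the two components. -/
def sumNorms {E F : Type*} (ν : MatrixNorms E) (ρ : MatrixNorms F) : MatrixNorms (E × F) :=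
  fun n x => max (ν n (x.map Prod.fst)) (ρ n (x.map Prod.snd))

/-- The operator space structure of a subspace. -/
def subNorms {E : Type*} [AddCommGroup E] [Module ℂ E] (ν : MatrixNorms E)
    (S : Submodule ℂ E) : MatrixNorms S :=
  fun n x => ν n (x.map Subtype.val)

/-- The quotient operator space structure: `Mₙ(E / N) = Mₙ(E) / Mₙ(N)` with the quotient norm. -/
def quotientNorms {E : Type*} [AddCommGroup E] [Module ℂ E] (ν : MatrixNorms E)
    (N : Submodule ℂ E) : MatrixNorms (E ⧸ N) :=
  fun n x => sInf {r : ℝ | ∃ y : Matrix (Fin n) (Fin n) E, y.map N.mkQ = x ∧ ν n y = r}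

/-- A linear isomorphism is completely isometric if it preserves the norm of `Mₙ` for every `n`. -/
def IsCompletelyIsometric {E F : Type*} [AddCommGroup E] [Module ℂ E] [AddCommGroup F]
    [Module ℂ F] (ν : MatrixNorms E) (ρ : MatrixNorms F) (φ : E ≃ₗ[ℂ] F) : Prop :=
  ∀ (n : ℕ) (x : Matrix (Fin n) (Fin n) E), ρ n (x.map φ) = ν n x

/-- The operator space `R ⊕ C`, where `R = (ℓ₂)_r` and `C = (ℓ₂)_c`. -/
def rowPlusCol : MatrixNorms (Ell2 × Ell2) := sumNorms (rowNorms Ell2) (colNorms Ell2)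

/-- The matrix `[⟨yᵢⱼ, xₖₗ⟩]` with rows `(i, k)` and columns `(j, l)`. In coordinates it is
`∑ₚ conj(yₚ) ⊗ xₚ`. -/
def gram {n m : ℕ} (y : Matrix (Fin n) (Fin n) Ell2) (x : Matrix (Fin m) (Fin m) Ell2) :
    Matrix (Fin n × Fin m) (Fin n × Fin m) ℂ :=
  Matrix.of fun p q => inner ℂ (y p.1 q.1) (x p.2 q.2)

/-- The operator norm of a scalar matrix on the Euclidean space. -/
def matNorm {ι : Type*} [Fintype ι] [DecidableEq ι] (A : Matrix ι ι ℂ) : ℝ :=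
  ‖Matrix.toEuclideanCLM (n := ι) (𝕜 := ℂ) A‖

/-- The operator Hilbert space `OH`: the space `ℓ₂` with
`‖x‖_{Mₙ(OH)} = ‖[⟨xᵢⱼ, xₖₗ⟩]‖^{1/2}`, that is `‖∑ₚ xₚ ⊗ conj(xₚ)‖_{min}^{1/2}` for
`x = ∑ₚ xₚ ⊗ eₚ`. By `ohNorms_isSelfDual` and `IsSelfDual.eq_ohNorms` it is the unique
operator space structure on `ℓ₂` that is canonically completely isometric to its anti-dual. -/
def ohNorms : MatrixNorms Ell2 := fun _ x => Real.sqrt (matNorm (gram x x))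

/-! ### `OH` is the unique canonically self-dual structure on `ℓ₂`

This justifies the definition of `ohNorms`. -/

section SelfDual

open scoped ComplexOrder
open Matrix

/-- The square of the Hilbert-Schmidt norm of a matrix. -/
def frob {a b : Type*} [Fintype a] [Fintype b] (A : Matrix a b ℂ) : ℝ := ∑ i, ∑ j, ‖A i j‖ ^ 2

lemma frob_eq_trace {a b : Type*} [Fintype a] [Fintype b] (A : Matrix a b ℂ) :
    ((frob A : ℝ) : ℂ) = (A * Aᴴ).trace := by
  simp [frob, Matrix.trace, Matrix.mul_apply, Complex.mul_conj, Complex.normSq_eq_norm_sq]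

lemma frob_gram {a b : Type*} [Fintype a] [Fintype b] (A : Matrix a b ℂ) :
    frob (A * Aᴴ) = frob (Aᴴ * A) := by
  have : ((frob (A * Aᴴ) : ℝ) : ℂ) = (frob (Aᴴ * A) : ℝ) := by
    rw [frob_eq_trace, frob_eq_trace, conjTranspose_mul, conjTranspose_mul,
      conjTranspose_conjTranspose, Matrix.mul_assoc, Matrix.trace_mul_comm A, Matrix.mul_assoc,
      Matrix.mul_assoc, Matrix.mul_assoc]
  exact_mod_cast this

lemma exists_factor {n m : ℕ} (V : Matrix (Fin n) (Fin m) ℂ) :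
    ∃ (P : Matrix (Fin n) (Fin n) ℂ) (Q : Matrix (Fin n) (Fin m) ℂ), V = P * Q ∧
      frob (P * Pᴴ) = frob V ∧ frob (Qᴴ * Q) = frob V := by
  have hH : (V * Vᴴ).PosSemidef := posSemidef_self_mul_conjTranspose V
  set U : Matrix (Fin n) (Fin n) ℂ := (hH.1.eigenvectorUnitary : Matrix (Fin n) (Fin n) ℂ) with hU
  set d := hH.1.eigenvalues with hd
  have hUU : U * Uᴴ = 1 := (Matrix.mem_unitaryGroup_iff).1 hH.1.eigenvectorUnitary.2
  have hUU' : Uᴴ * U = 1 := (Matrix.mem_unitaryGroup_iff').1 hH.1.eigenvectorUnitary.2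
  have hd0 : ∀ i, 0 ≤ d i := hH.eigenvalues_nonneg
  set D : Matrix (Fin n) (Fin n) ℂ := diagonal (fun i => ((d i : ℝ) : ℂ)) with hD
  have hspec : V * Vᴴ = U * D * Uᴴ := hH.1.spectral_theorem
  set B := Uᴴ * V with hB
  have hBB : B * Bᴴ = D := by
    rw [hB, conjTranspose_mul, conjTranspose_conjTranspose, Matrix.mul_assoc, ← Matrix.mul_assoc V,
      hspec]
    calc Uᴴ * (U * D * Uᴴ * U) = (Uᴴ * U) * D * (Uᴴ * U) := by simp only [Matrix.mul_assoc]
      _ = D := by rw [hUU', Matrix.one_mul, Matrix.mul_one]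
  have hV : U * B = V := by rw [hB, ← Matrix.mul_assoc, hUU, Matrix.one_mul]
  set α : Fin n → ℝ := fun i => √(√(d i)) with hα
  have hα2 : ∀ i, α i * α i = √(d i) := fun i => Real.mul_self_sqrt (Real.sqrt_nonneg _)
  have hd2 : ∀ i, √(d i) * √(d i) = d i := fun i => Real.mul_self_sqrt (hd0 i)
  have hfV : frob V = ∑ i, d i := by
    have : ((frob V : ℝ) : ℂ) = ((∑ i, d i : ℝ) : ℂ) := by
      rw [frob_eq_trace, hspec, Matrix.trace_mul_comm, ← Matrix.mul_assoc, hUU', Matrix.one_mul, hD,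
        Matrix.trace_diagonal]
      push_cast; rfl
    exact_mod_cast this
  have hdiag : ∀ A : Matrix (Fin n) (Fin n) ℂ, A = diagonal (fun i => ((√(d i) : ℝ) : ℂ)) →
      frob A = frob V := by
    rintro A rfl
    have : ((frob (diagonal (fun i => ((√(d i) : ℝ) : ℂ))) : ℝ) : ℂ) = ((∑ i, d i : ℝ) : ℂ) := by
      rw [frob_eq_trace, diagonal_conjTranspose, diagonal_mul_diagonal, trace_diagonal]
      push_cast
      refine Finset.sum_congr rfl fun i _ => ?_
      simp only [Pi.star_apply, Complex.star_def, Complex.conj_ofReal]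
      rw [← Complex.ofReal_mul, hd2]
    rw [hfV]; exact_mod_cast this
  refine ⟨U * diagonal (fun i => ((α i : ℝ) : ℂ)), diagonal (fun i => (((α i)⁻¹ : ℝ) : ℂ)) * B,
    ?_, ?_, ?_⟩
  · rw [Matrix.mul_assoc, ← Matrix.mul_assoc (diagonal _), diagonal_mul_diagonal]
    conv_lhs => rw [← hV]
    congr 1
    ext i j
    rw [diagonal_mul]
    by_cases h : d i = 0
    · have h1 : ∑ l, ‖B i l‖ ^ 2 = 0 := by
        have : ((∑ l, ‖B i l‖ ^ 2 : ℝ) : ℂ) = 0 := by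
          have h2 := congrFun (congrFun hBB i) i
          rw [hD, diagonal_apply_eq, h, Matrix.mul_apply] at h2
          rw [← Complex.ofReal_zero, ← h2]
          simp [Complex.mul_conj, Complex.normSq_eq_norm_sq]
        exact_mod_cast this
      have h3 := (Finset.sum_eq_zero_iff_of_nonneg (fun l _ => by positivity)).1 h1 j
        (Finset.mem_univ j)
      have h4 : B i j = 0 := by simpa using h3
      rw [h4, mul_zero]
    · have : α i ≠ 0 := by
        have := lt_of_le_of_ne (hd0 i) (Ne.symm h)
        exact (Real.sqrt_pos.2 (Real.sqrt_pos.2 this)).ne'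
      rw [← Complex.ofReal_mul, mul_inv_cancel₀ this, Complex.ofReal_one, one_mul]
  · rw [frob_gram]
    apply hdiag
    rw [conjTranspose_mul, Matrix.mul_assoc, ← Matrix.mul_assoc Uᴴ, hUU', Matrix.one_mul,
      diagonal_conjTranspose, diagonal_mul_diagonal]
    congr 1; funext i
    simp only [Pi.star_apply, Complex.star_def, Complex.conj_ofReal]
    rw [← Complex.ofReal_mul, hα2]
  · rw [← frob_gram]
    apply hdiag
    rw [conjTranspose_mul, Matrix.mul_assoc, ← Matrix.mul_assoc B, hBB,
      diagonal_conjTranspose, hD, diagonal_mul_diagonal, diagonal_mul_diagonal]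
    congr 1; funext i
    simp only [Pi.star_apply, Complex.star_def, Complex.conj_ofReal]
    rw [← Complex.ofReal_mul, ← Complex.ofReal_mul]
    congr 1
    by_cases h : d i = 0
    · simp [h]
    · have h1 : √(d i) ≠ 0 := (Real.sqrt_pos.2 (lt_of_le_of_ne (hd0 i) (Ne.symm h))).ne'
      have h2 : (α i)⁻¹ * (α i)⁻¹ = (√(d i))⁻¹ := by rw [← mul_inv, hα2]
      calc (α i)⁻¹ * (d i * (α i)⁻¹) = d i * ((α i)⁻¹ * (α i)⁻¹) := by ring
        _ = √(d i) := by rw [h2]; nth_rewrite 1 [← hd2 i]; field_simp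


/-- The sesquilinear form of the matrix `gram y x`. -/
def gramForm {n m : ℕ} (y : Matrix (Fin n) (Fin n) Ell2) (x : Matrix (Fin m) (Fin m) Ell2)
    (W V : Matrix (Fin n) (Fin m) ℂ) : ℂ :=
  ∑ i, ∑ k, ∑ j, ∑ l, star (W i k) * inner ℂ (y i j) (x k l) * V j l

/-- A matrix as a vector of the Euclidean space. -/
def toVec {n m : ℕ} (W : Matrix (Fin n) (Fin m) ℂ) : EuclideanSpace ℂ (Fin n × Fin m) :=
  WithLp.toLp 2 fun p => W p.1 p.2

lemma norm_toVec {n m : ℕ} (W : Matrix (Fin n) (Fin m) ℂ) : ‖toVec W‖ = √(frob W) := by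
  rw [EuclideanSpace.norm_eq, frob, Fintype.sum_prod_type]; rfl

lemma inner_toVec {n m : ℕ} (y : Matrix (Fin n) (Fin n) Ell2) (x : Matrix (Fin m) (Fin m) Ell2)
    (W V : Matrix (Fin n) (Fin m) ℂ) :
    inner ℂ (toVec W) (Matrix.toEuclideanCLM (n := Fin n × Fin m) (𝕜 := ℂ) (gram y x) (toVec V))
      = gramForm y x W V := by
  simp only [toVec, Matrix.toEuclideanCLM_toLp, PiLp.inner_apply, Fintype.sum_prod_type, gramForm,
    Matrix.mulVec, dotProduct, gram, Matrix.of_apply, RCLike.inner_apply, Finset.sum_mul,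
    starRingEnd_apply]
  refine Finset.sum_congr rfl fun i _ => Finset.sum_congr rfl fun k _ =>
    Finset.sum_congr rfl fun j _ => Finset.sum_congr rfl fun l _ => by ring

lemma norm_gramForm_le {n m : ℕ} (y : Matrix (Fin n) (Fin n) Ell2) (x : Matrix (Fin m) (Fin m) Ell2)
    (W V : Matrix (Fin n) (Fin m) ℂ) :
    ‖gramForm y x W V‖ ≤ matNorm (gram y x) * (√(frob W) * √(frob V)) := by
  rw [← inner_toVec, ← norm_toVec, ← norm_toVec]
  refine (norm_inner_le_norm _ _).trans ?_
  calc _ ≤ ‖toVec W‖ * (matNorm (gram y x) * ‖toVec V‖) :=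
        mul_le_mul_of_nonneg_left (ContinuousLinearMap.le_opNorm _ _) (norm_nonneg _)
    _ = _ := by ring

lemma matNorm_le_of_gramForm {n m : ℕ} {y : Matrix (Fin n) (Fin n) Ell2}
    {x : Matrix (Fin m) (Fin m) Ell2} {c : ℝ} (hc : 0 ≤ c)
    (h : ∀ W V, ‖gramForm y x W V‖ ≤ c * (√(frob W) * √(frob V))) : matNorm (gram y x) ≤ c := by
  refine ContinuousLinearMap.opNorm_le_bound _ hc fun v => ?_
  set T := Matrix.toEuclideanCLM (n := Fin n × Fin m) (𝕜 := ℂ) (gram y x)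
  have key : ∀ w v : EuclideanSpace ℂ (Fin n × Fin m), ‖inner ℂ w (T v)‖ ≤ c * (‖w‖ * ‖v‖) := by
    intro w v
    have := h (Matrix.of fun i k => w (i, k)) (Matrix.of fun i k => v (i, k))
    rw [← inner_toVec, ← norm_toVec, ← norm_toVec] at this
    exact this
  have h1 := key (T v) v
  rw [inner_self_eq_norm_sq_to_K, norm_pow, RCLike.norm_ofReal, abs_norm, sq] at h1
  rcases (norm_nonneg (T v)).eq_or_lt with h0 | h0
  · rw [← h0]; positivity
  · refine le_of_mul_le_mul_left ?_ h0
    linarith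

/-- The matrix `Rᵀ y conj(P)`, transposed. -/
def lft {n a b : ℕ} (R : Matrix (Fin n) (Fin a) ℂ) (P : Matrix (Fin n) (Fin b) ℂ)
    (y : Matrix (Fin n) (Fin n) Ell2) (s : Fin b) (t : Fin a) : Ell2 :=
  ∑ i, ∑ j, (R i t * star (P j s)) • y i j

lemma gramForm_mul {n m a b : ℕ} (y : Matrix (Fin n) (Fin n) Ell2) (x : Matrix (Fin m) (Fin m) Ell2)
    (R : Matrix (Fin n) (Fin a) ℂ) (T : Matrix (Fin a) (Fin m) ℂ)
    (P : Matrix (Fin n) (Fin b) ℂ) (Q : Matrix (Fin b) (Fin m) ℂ) :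
    gramForm y x (R * T) (P * Q) = ∑ s, ∑ t, inner ℂ (lft R P y s t) (lft Tᴴ Qᴴ x s t) := by
  simp only [lft, sum_inner, inner_sum, inner_smul_left, inner_smul_right, gramForm, Matrix.mul_apply,
    star_sum, Finset.sum_mul, Finset.mul_sum, ← Fintype.sum_prod_type']
  let e : Fin n × Fin m × Fin n × Fin m × Fin b × Fin a ≃
      Fin b × Fin a × (Fin m × Fin m) × Fin n × Fin n :=
    ⟨fun p => (p.2.2.2.2.1, p.2.2.2.2.2, (p.2.1, p.2.2.2.1), p.1, p.2.2.1),
      fun q => (q.2.2.2.1, q.2.2.1.1, q.2.2.2.2, q.2.2.1.2, q.1, q.2.1), fun _ => rfl,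
      fun _ => rfl⟩
  refine Fintype.sum_equiv e _ _ ?_
  rintro ⟨i, k, j, l, s, t⟩
  simp only [e, Equiv.coe_fn_mk, star_mul', map_mul, Matrix.conjTranspose_apply, star_star,
    starRingEnd_apply]
  ring

lemma sum_lft {n a b : ℕ} (y : Matrix (Fin n) (Fin n) Ell2) (R : Matrix (Fin n) (Fin a) ℂ)
    (P : Matrix (Fin n) (Fin b) ℂ) :
    ∑ s, ∑ t, ‖lft R P y s t‖ ^ 2 ≤
      matNorm (gram y y) * (√(frob (R * Rᴴ)) * √(frob (P * Pᴴ))) := by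
  have h := gramForm_mul y y R Rᴴ P Pᴴ
  rw [conjTranspose_conjTranspose, conjTranspose_conjTranspose] at h
  have h2 : gramForm y y (R * Rᴴ) (P * Pᴴ) = ((∑ s, ∑ t, ‖lft R P y s t‖ ^ 2 : ℝ) : ℂ) := by
    rw [h]; push_cast
    refine Finset.sum_congr rfl fun s _ => Finset.sum_congr rfl fun t _ => ?_
    rw [inner_self_eq_norm_sq_to_K]; rfl
  have h3 := norm_gramForm_le y y (R * Rᴴ) (P * Pᴴ)
  rw [h2, Complex.norm_real] at h3
  exact (le_abs_self _).trans h3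

lemma matNorm_nonneg {ι : Type*} [Fintype ι] [DecidableEq ι] (A : Matrix ι ι ℂ) : 0 ≤ matNorm A :=
  norm_nonneg _

theorem matNorm_gram_le {n m : ℕ} (y : Matrix (Fin n) (Fin n) Ell2)
    (x : Matrix (Fin m) (Fin m) Ell2) : matNorm (gram y x) ≤ ohNorms n y * ohNorms m x := by
  refine matNorm_le_of_gramForm (mul_nonneg (Real.sqrt_nonneg _) (Real.sqrt_nonneg _)) fun W V => ?_
  obtain ⟨R, T, hW, hR, hT⟩ := exists_factor W
  obtain ⟨P, Q, hV, hP, hQ⟩ := exists_factor V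
  have e1 := sum_lft y R P
  have e2 := sum_lft x Tᴴ Qᴴ
  rw [conjTranspose_conjTranspose, conjTranspose_conjTranspose, hT, hQ] at e2
  rw [hR, hP] at e1
  have hpair : gramForm y x W V = ∑ s, ∑ t, inner ℂ (lft R P y s t) (lft Tᴴ Qᴴ x s t) := by
    rw [← gramForm_mul, ← hW, ← hV]
  rw [hpair]
  have hcs : ‖∑ s, ∑ t, inner ℂ (lft R P y s t) (lft Tᴴ Qᴴ x s t)‖ ≤
      √(∑ s, ∑ t, ‖lft R P y s t‖ ^ 2) * √(∑ s, ∑ t, ‖lft Tᴴ Qᴴ x s t‖ ^ 2) := by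
    rw [← Fintype.sum_prod_type', ← Fintype.sum_prod_type', ← Fintype.sum_prod_type']
    refine (norm_sum_le _ _).trans ((Finset.sum_le_sum fun p _ => norm_inner_le_norm _ _).trans ?_)
    exact Real.sum_mul_le_sqrt_mul_sqrt _ _ _
  refine hcs.trans ((mul_le_mul (Real.sqrt_le_sqrt e1) (Real.sqrt_le_sqrt e2)
    (Real.sqrt_nonneg _) (Real.sqrt_nonneg _)).trans (le_of_eq ?_))
  rw [Real.sqrt_mul (matNorm_nonneg _), Real.sqrt_mul (matNorm_nonneg _)]
  have h : √(√(frob W) * √(frob V)) * √(√(frob W) * √(frob V)) = √(frob W) * √(frob V) :=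
    Real.mul_self_sqrt (by positivity)
  unfold ohNorms
  linear_combination (√(matNorm (gram y y)) * √(matNorm (gram x x))) * h

/-- Canonical self-duality of an operator space structure `ν` on `ℓ₂`: the canonical map
`y ↦ ⟨y, ·⟩` onto the anti-dual is completely isometric, where the norm of `[⟨yᵢⱼ, ·⟩]` in
`Mₙ` of the dual is its norm as a completely bounded map into `Mₙ`, that is the supremum of
`‖[⟨yᵢⱼ, xₖₗ⟩]‖` over the unit balls of all the `Mₘ`. -/
def IsSelfDual (ν : MatrixNorms Ell2) : Prop :=
  ∀ (n : ℕ) (y : Matrix (Fin n) (Fin n) Ell2),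
    IsLUB {r : ℝ | ∃ (m : ℕ) (x : Matrix (Fin m) (Fin m) Ell2), ν m x ≤ 1 ∧ matNorm (gram y x) = r}
      (ν n y)

lemma gram_smul {n m : ℕ} (y : Matrix (Fin n) (Fin n) Ell2) (x : Matrix (Fin m) (Fin m) Ell2)
    (c : ℂ) : gram y (c • x) = c • gram y x := by
  ext p q; simp [gram]

lemma matNorm_smul {ι : Type*} [Fintype ι] [DecidableEq ι] (A : Matrix ι ι ℂ) (c : ℂ) :
    matNorm (c • A) = ‖c‖ * matNorm A := by
  rw [matNorm, map_smul, norm_smul]; rfl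

lemma gram_smul_left {n m : ℕ} (y : Matrix (Fin n) (Fin n) Ell2) (x : Matrix (Fin m) (Fin m) Ell2)
    (c : ℂ) : gram (c • y) x = star c • gram y x := by
  ext p q; simp [gram, mul_comm]

lemma ohNorms_smul {n : ℕ} (x : Matrix (Fin n) (Fin n) Ell2) (c : ℂ) :
    ohNorms n (c • x) = ‖c‖ * ohNorms n x := by
  rw [ohNorms, gram_smul, gram_smul_left, matNorm_smul, matNorm_smul, norm_star, ← mul_assoc,
    Real.sqrt_mul (by positivity), Real.sqrt_mul_self (norm_nonneg _), ohNorms]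

lemma ohNorms_sq {n : ℕ} (x : Matrix (Fin n) (Fin n) Ell2) :
    ohNorms n x * ohNorms n x = matNorm (gram x x) := Real.mul_self_sqrt (matNorm_nonneg _)

/-- `OH` is canonically self-dual. -/
theorem ohNorms_isSelfDual : IsSelfDual ohNorms := by
  intro n y
  constructor
  · rintro r ⟨m, x, hx, rfl⟩
    exact (matNorm_gram_le y x).trans
      (mul_le_of_le_one_right (Real.sqrt_nonneg _) hx)
  · intro c hc
    have hpos : 0 ≤ ohNorms n y := Real.sqrt_nonneg _
    rcases hpos.eq_or_lt with h0 | h0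
    · rw [← h0]
      refine (matNorm_nonneg _).trans (hc ⟨0, 0, ?_, rfl⟩)
      have : gram (0 : Matrix (Fin 0) (Fin 0) Ell2) (0 : Matrix (Fin 0) (Fin 0) Ell2) = 0 := by ext p; exact p.1.elim0
      simp [ohNorms, this, matNorm]
    · have hn : ‖((ohNorms n y)⁻¹ : ℂ)‖ = (ohNorms n y)⁻¹ := by
        rw [norm_inv, Complex.norm_real, Real.norm_of_nonneg h0.le]
      refine hc ⟨n, ((ohNorms n y)⁻¹ : ℂ) • y, ?_, ?_⟩
      · rw [ohNorms_smul, hn, inv_mul_cancel₀ h0.ne']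
      · rw [gram_smul, matNorm_smul, hn, ← ohNorms_sq, ← mul_assoc, inv_mul_cancel₀ h0.ne', one_mul]

/-- `OH` is the only canonically self-dual operator space structure on `ℓ₂`. -/
theorem IsSelfDual.eq_ohNorms {ν : MatrixNorms Ell2} (h : IsSelfDual ν) : ν = ohNorms := by
  have h0 : ∀ n y, 0 ≤ ν n y := by
    intro n y
    by_contra! hneg
    have := (h n y).1 ⟨n, y, hneg.le.trans zero_le_one, rfl⟩
    linarith [matNorm_nonneg (gram y y)]
  -- the upper bound at a scalar multiple gives homogeneity
  have hs : ∀ n (y : Matrix (Fin n) (Fin n) Ell2) (c : ℂ), ν n (c • y) ≤ ‖c‖ * ν n y := by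
    intro n y c
    refine (h n (c • y)).2 ?_
    rintro r ⟨m, x, hx, rfl⟩
    rw [gram_smul_left, matNorm_smul, norm_star]
    exact mul_le_mul_of_nonneg_left ((h n y).1 ⟨m, x, hx, rfl⟩) (norm_nonneg _)
  have hge : ∀ n (y : Matrix (Fin n) (Fin n) Ell2), ohNorms n y ≤ ν n y := by
    intro n y
    have key : ∀ t : ℝ, ν n y < t → matNorm (gram y y) ≤ t * t := by
      intro t ht
      have ht0 : 0 < t := (h0 n y).trans_lt ht
      have hn : ‖((t)⁻¹ : ℂ)‖ = t⁻¹ := by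
        rw [norm_inv, Complex.norm_real, Real.norm_of_nonneg ht0.le]
      have h1 : ν n ((t⁻¹ : ℂ) • y) ≤ 1 := by
        refine (hs n y _).trans ?_
        rw [hn, inv_mul_le_one₀ ht0]; exact ht.le
      have h2 := (h n y).1 ⟨n, _, h1, rfl⟩
      rw [gram_smul, matNorm_smul, hn, inv_mul_le_iff₀ ht0] at h2
      exact h2.trans (mul_le_mul_of_nonneg_left ht.le ht0.le)
    refine le_of_forall_gt_imp_ge_of_dense fun t ht => ?_
    exact Real.sqrt_le_iff.2 ⟨(h0 n y).trans ht.le, by rw [sq]; exact key t ht⟩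
  funext n y
  refine le_antisymm ((h n y).2 ?_) (hge n y)
  rintro r ⟨m, x, hx, rfl⟩
  exact (matNorm_gram_le y x).trans
    (mul_le_of_le_one_right (Real.sqrt_nonneg _) ((hge m x).trans hx))

end SelfDual

/-! ### The Hardy space of the strip -/

/-- The strip `{z | 0 < Re z < 1}`. -/
def strip : Set ℂ := {z : ℂ | 0 < z.re ∧ z.re < 1}

/-- The probability measure `dt / cosh (π t)` on the vertical line `{x + i t | t ∈ ℝ}`.
For `x = 0` and `x = 1` these are `μ₀` and `μ₁`: the harmonic measure of the point `1 / 2` in the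
strip is `(μ₀ + μ₁) / 2`. -/
def lineMeasure (x : ℝ) : Measure ℂ :=
  ((volume : Measure ℝ).withDensity
      (fun t => ENNReal.ofReal (1 / Real.cosh (Real.pi * t)))).map
    (fun t : ℝ => (x : ℂ) + (t : ℂ) * Complex.I)

/-- `L₂(μ₀; ℓ₂)`. -/
abbrev L2left : Type := Lp Ell2 2 (lineMeasure 0)

/-- `L₂(μ₁; ℓ₂)`. -/
abbrev L2right : Type := Lp Ell2 2 (lineMeasure 1)

/-- The operator space structure of `L₂(μ₀; ℓ₂)_r ⊕ L₂(μ₁; ℓ₂)_c`. -/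
def bdryNorms : MatrixNorms (L2left × L2right) := sumNorms (rowNorms L2left) (colNorms L2right)

/-- Bounded continuous functions on the closed strip that are holomorphic in the strip. -/
def IsBddHol (f : ℂ → Ell2) : Prop :=
  DiffContOnCl ℂ f strip ∧ ∃ c : ℝ, ∀ z ∈ closure strip, ‖f z‖ ≤ c

/-- `g` is the pair of restrictions of `f` to the two boundary lines of the strip. -/
def IsBdryValue (f : ℂ → Ell2) (g : L2left × L2right) : Prop :=
  (g.1 : ℂ → Ell2) =ᵐ[lineMeasure 0] f ∧ (g.2 : ℂ → Ell2) =ᵐ[lineMeasure 1] f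

lemma IsBddHol.add {f f' : ℂ → Ell2} (h : IsBddHol f) (h' : IsBddHol f') :
    IsBddHol (f + f') := by
  obtain ⟨h1, c, hc⟩ := h
  obtain ⟨h1', c', hc'⟩ := h'
  exact ⟨h1.add h1', c + c', fun z hz =>
    (norm_add_le _ _).trans (add_le_add (hc z hz) (hc' z hz))⟩

lemma IsBddHol.smul {f : ℂ → Ell2} (a : ℂ) (h : IsBddHol f) : IsBddHol (a • f) := by
  obtain ⟨h1, c, hc⟩ := h
  refine ⟨h1.const_smul a, ‖a‖ * c, fun z hz => ?_⟩
  rw [Pi.smul_apply, norm_smul]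
  exact mul_le_mul_of_nonneg_left (hc z hz) (norm_nonneg a)

lemma isBddHol_zero : IsBddHol 0 :=
  ⟨diffContOnCl_const, 0, fun z _ => by simp⟩

lemma IsBdryValue.add {f f' : ℂ → Ell2} {g g' : L2left × L2right} (h : IsBdryValue f g)
    (h' : IsBdryValue f' g') : IsBdryValue (f + f') (g + g') :=
  ⟨(Lp.coeFn_add g.1 g'.1).trans (h.1.add h'.1), (Lp.coeFn_add g.2 g'.2).trans (h.2.add h'.2)⟩

lemma IsBdryValue.smul {f : ℂ → Ell2} {g : L2left × L2right} (a : ℂ) (h : IsBdryValue f g) :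
    IsBdryValue (a • f) (a • g) :=
  ⟨(Lp.coeFn_smul a g.1).trans (h.1.const_smul a), (Lp.coeFn_smul a g.2).trans (h.2.const_smul a)⟩

lemma isBdryValue_zero : IsBdryValue 0 0 :=
  ⟨Lp.coeFn_zero _ _ _, Lp.coeFn_zero _ _ _⟩

/-- The boundary values of the bounded continuous functions on the closed strip that are
holomorphic in the strip. -/
def bddHolBdry : Submodule ℂ (L2left × L2right) where
  carrier := {g | ∃ f, IsBddHol f ∧ IsBdryValue f g}
  zero_mem' := ⟨0, isBddHol_zero, isBdryValue_zero⟩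
  add_mem' := by
    rintro _ _ ⟨f, hf, hg⟩ ⟨f', hf', hg'⟩
    exact ⟨f + f', hf.add hf', hg.add hg'⟩
  smul_mem' := by
    rintro a _ ⟨f, hf, hg⟩
    exact ⟨a • f, hf.smul a, hg.smul a⟩

/-- The space `G`, that is the `ℓ₂`-valued Hardy space `H²` of the strip, viewed as a space of
boundary values: the closure of `bddHolBdry` in `L₂(μ₀; ℓ₂) ⊕ L₂(μ₁; ℓ₂)`. -/
def hardy : Submodule ℂ (L2left × L2right) := bddHolBdry.topologicalClosure

/-- `f` is the analytic extension to the strip of the boundary function `g ∈ G`: there are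
`f_k`, bounded and continuous on the closed strip and holomorphic in the strip, whose boundary
values converge to `g` in `L₂` and which converge to `f` locally uniformly in the strip. -/
def IsAnalyticExtension (f : ℂ → Ell2) (g : L2left × L2right) : Prop :=
  DifferentiableOn ℂ f strip ∧
    ∃ (F : ℕ → ℂ → Ell2) (b : ℕ → L2left × L2right),
      (∀ k, IsBddHol (F k) ∧ IsBdryValue (F k) (b k)) ∧
      Tendsto b atTop (𝓝 g) ∧ TendstoLocallyUniformlyOn F f atTop strip

lemma IsAnalyticExtension.add {f f' : ℂ → Ell2} {g g' : L2left × L2right}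
    (h : IsAnalyticExtension f g) (h' : IsAnalyticExtension f' g') :
    IsAnalyticExtension (f + f') (g + g') := by
  obtain ⟨hd, F, b, hF, hb, hu⟩ := h
  obtain ⟨hd', F', b', hF', hb', hu'⟩ := h'
  exact ⟨hd.add hd', F + F', b + b', fun k =>
    ⟨(hF k).1.add (hF' k).1, (hF k).2.add (hF' k).2⟩, hb.add hb', hu.add hu'⟩

lemma IsAnalyticExtension.smul {f : ℂ → Ell2} {g : L2left × L2right} (a : ℂ)
    (h : IsAnalyticExtension f g) : IsAnalyticExtension (a • f) (a • g) := by
  obtain ⟨hd, F, b, hF, hb, hu⟩ := h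
  refine ⟨hd.const_smul a, fun k => a • F k, fun k => a • b k, fun k =>
    ⟨(hF k).1.smul a, (hF k).2.smul a⟩, hb.const_smul a, ?_⟩
  exact (uniformContinuous_const_smul a).comp_tendstoLocallyUniformlyOn hu

lemma isAnalyticExtension_zero : IsAnalyticExtension 0 0 :=
  ⟨differentiableOn_const 0, fun _ => 0, fun _ => 0,
    fun _ => ⟨isBddHol_zero, isBdryValue_zero⟩, tendsto_const_nhds,
    fun u hu z _ => ⟨Set.univ, univ_mem, by
      filter_upwards with k w _
      exact refl_mem_uniformity hu⟩⟩

/-- The subspace `N` of those `f ∈ G` with `f (1 / 2) = 0`. -/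
def hardyVanishing : Submodule ℂ hardy where
  carrier := {g | ∃ f, IsAnalyticExtension f (g : L2left × L2right) ∧ f (1 / 2) = 0}
  zero_mem' := ⟨0, isAnalyticExtension_zero, rfl⟩
  add_mem' := by
    rintro g g' ⟨f, hf, h0⟩ ⟨f', hf', h0'⟩
    exact ⟨f + f', hf.add hf', by rw [Pi.add_apply, h0, h0', add_zero]⟩
  smul_mem' := by
    rintro a g ⟨f, hf, h0⟩
    exact ⟨a • f, hf.smul a, by rw [Pi.smul_apply, h0, smul_zero]⟩

end OpSpace

end

noncomputable section

namespace OpSpace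

/-! ### The Poisson formula in the strip -/

/-! This is complex interpolation between the row and the column structure, carried out by hand on
the strip. Evaluation at `1 / 2` maps `G` onto `ℓ₂` with kernel `N`, so everything reduces to two
estimates for matrices: evaluation is a complete contraction into `OH`, and matrices over `OH` lift
to `G` with almost no loss of norm.

The analytic input is the Poisson formula on the strip, obtained from Cauchy's theorem for `(f z - f
x) / (cos πz - cos πx)`. At `1 / 2` it averages `f` over the two boundary lines. At other points it
bounds `f` locally by its boundary values, which gives existence and uniqueness of analytic
extensions (`exists_isAnalyticExtension`, `IsAnalyticExtension.eqOn`). Multiplying `f` by an outer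
function of moduli `a` and `b` on the two lines, whose modulus at `1 / 2` is `√(ab)`, yields the
weighted inequality `norm_evalHalf_sq_le`.

The norm of a Gram matrix is determined by its form at pairs of positive matrices
(`matNorm_gram_le_of_conjDiag`). Diagonalizing such a pair by unitaries `U` and `P` turns the form
into `∑ α_t β_s ‖x̂_st‖²`, where `x̂ = hat U P x`; row and column norms are bounds on the sums of
`‖ŷ_st‖²` over `s` and over `t`. Contractivity (`ohNorms_evalHalf_le`) is then the weighted scalar
inequality applied to each coefficient and summed.

Conversely, for prescribed diagonal weights each coefficient is lifted by an outer function times a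
vector, with moduli `p` and `p⁻¹` chosen to balance the two sides (`exists_lift_diag`). This lift
depends on the weights. A Hahn–Banach separation, playing the part of a minimax theorem, replaces it
by one lift that is good for all weights at once (`exists_lift`).

Finally, row and column norms depend only on the Hilbert space, and both boundary `L₂` spaces are
separable and infinite-dimensional, so `E` can be replaced by `R ⊕ C`. -/

lemma closure_strip : closure strip = {z : ℂ | 0 ≤ z.re ∧ z.re ≤ 1} := by
  have : strip = Complex.re ⁻¹' Set.Ioo 0 1 := rfl
  rw [this, Complex.closure_preimage_re, closure_Ioo zero_ne_one]
  rfl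

lemma isOpen_strip : IsOpen strip :=
  (isOpen_lt continuous_const Complex.continuous_re).inter
    (isOpen_lt Complex.continuous_re continuous_const)

/-! ### Integrals of the Poisson kernels -/

lemma cosh_sub_pos {c : ℝ} (hc : c < 1) (t : ℝ) : 0 < Real.cosh (Real.pi * t) - c := by
  linarith [Real.one_le_cosh (Real.pi * t)]

/-- Since `s² + c² = 1`, one has `cosh πt - c = (s² + (e^{πt} - c)²) / (2 e^{πt})`, so the
substitution `u = e^{πt}` leads to an arctangent. The case of interest is `s = sin πx`, `c = ± cos
πx`. -/
lemma hasDerivAt_arctan_exp {s c : ℝ} (hs : 0 < s) (h : s ^ 2 + c ^ 2 = 1) (t : ℝ) :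
    HasDerivAt (fun t => 2 / (Real.pi * s) * Real.arctan ((Real.exp (Real.pi * t) - c) / s))
      (1 / (Real.cosh (Real.pi * t) - c)) t := by
  have hc : c < 1 := by nlinarith
  have h0 := cosh_sub_pos hc t
  have h1 : HasDerivAt (fun t : ℝ => (Real.exp (Real.pi * t) - c) / s)
      (Real.exp (Real.pi * t) * (Real.pi * 1) / s) t :=
    ((((hasDerivAt_id t).const_mul Real.pi).exp).sub_const c).div_const s
  convert! (h1.arctan).const_mul (2 / (Real.pi * s)) using 1
  have he := Real.exp_pos (Real.pi * t)
  have e : Real.cosh (Real.pi * t) - c =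
      (s ^ 2 + (Real.exp (Real.pi * t) - c) ^ 2) / (2 * Real.exp (Real.pi * t)) := by
    rw [Real.cosh_eq, Real.exp_neg]
    field_simp
    linear_combination -h
  have hp := Real.pi_pos
  have h3 : 0 < s ^ 2 + (Real.exp (Real.pi * t) - c) ^ 2 := by positivity
  rw [e]
  field_simp

lemma tendsto_arctan_exp_atTop {s : ℝ} (hs : 0 < s) (c : ℝ) :
    Tendsto (fun t => 2 / (Real.pi * s) * Real.arctan ((Real.exp (Real.pi * t) - c) / s)) atTop
      (𝓝 (2 / (Real.pi * s) * (Real.pi / 2))) := by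
  refine ((tendsto_nhds_of_tendsto_nhdsWithin Real.tendsto_arctan_atTop).comp ?_).const_mul _
  refine Tendsto.atTop_div_const hs ?_
  refine tendsto_atTop_add_const_right _ _ ?_
  exact Real.tendsto_exp_atTop.comp (tendsto_id.const_mul_atTop Real.pi_pos)

lemma tendsto_arctan_exp_atBot (s c : ℝ) :
    Tendsto (fun t => 2 / (Real.pi * s) * Real.arctan ((Real.exp (Real.pi * t) - c) / s)) atBot
      (𝓝 (2 / (Real.pi * s) * Real.arctan ((0 - c) / s))) := by
  refine ((Real.continuous_arctan.tendsto _).comp ?_).const_mul _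
  refine Tendsto.div_const ?_ _
  exact (Real.tendsto_exp_atBot.comp (tendsto_id.const_mul_atBot Real.pi_pos)).sub_const c

lemma integrable_cosh_sub {s c : ℝ} (hs : 0 < s) (h : s ^ 2 + c ^ 2 = 1) :
    Integrable (fun t : ℝ => 1 / (Real.cosh (Real.pi * t) - c)) := by
  have hc : c < 1 := by nlinarith
  have hcont : Continuous (fun t : ℝ => 1 / (Real.cosh (Real.pi * t) - c)) :=
    continuous_const.div (by fun_prop) fun t => (cosh_sub_pos hc t).ne'
  refine integrable_of_intervalIntegral_norm_tendsto (l := atTop) (a := fun T : ℝ => -T)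
    (b := fun T : ℝ => T) _ (fun i => ?_) tendsto_neg_atTop_atBot tendsto_id
    (((tendsto_arctan_exp_atTop hs c).sub
      ((tendsto_arctan_exp_atBot s c).comp tendsto_neg_atTop_atBot)).congr fun T => ?_)
  · exact (hcont.continuousOn.integrableOn_compact isCompact_Icc).mono_set Set.Ioc_subset_Icc_self
  · have : ∀ t : ℝ, ‖1 / (Real.cosh (Real.pi * t) - c)‖ = 1 / (Real.cosh (Real.pi * t) - c) :=
      fun t => Real.norm_of_nonneg (one_div_pos.2 (cosh_sub_pos hc t)).le
    simp only [this]
    exact (intervalIntegral.integral_eq_sub_of_hasDerivAt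
      (fun t _ => hasDerivAt_arctan_exp hs h t) (hcont.intervalIntegrable _ _)).symm

lemma integral_cosh_sub {s c : ℝ} (hs : 0 < s) (h : s ^ 2 + c ^ 2 = 1) :
    ∫ t : ℝ, 1 / (Real.cosh (Real.pi * t) - c) =
      2 / (Real.pi * s) * (Real.pi / 2) + 2 / (Real.pi * s) * Real.arctan (c / s) := by
  rw [integral_of_hasDerivAt_of_tendsto (hasDerivAt_arctan_exp hs h) (integrable_cosh_sub hs h)
    (tendsto_arctan_exp_atBot s c) (tendsto_arctan_exp_atTop hs c), zero_sub, neg_div,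
    Real.arctan_neg]
  ring

/-- The arctangent terms for `c` and `-c` cancel because `arctan` is odd. The value fixes the
normalization `sin πx / 2` of the Poisson formula. -/
lemma integral_cosh_add_integral_cosh {s c : ℝ} (hs : 0 < s) (h : s ^ 2 + c ^ 2 = 1) :
    (∫ t : ℝ, 1 / (Real.cosh (Real.pi * t) - c)) + ∫ t : ℝ, 1 / (Real.cosh (Real.pi * t) + c) =
      2 / s := by
  have h2 := integral_cosh_sub (c := -c) hs (by rw [neg_sq, h])
  simp only [sub_neg_eq_add] at h2
  rw [integral_cosh_sub hs h, h2, neg_div, Real.arctan_neg]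
  have := Real.pi_pos
  field_simp
  ring

/-! ### The contour integral behind the Poisson formula -/

lemma cos_pi_mul_ne {x : ℝ} (hx0 : 0 < x) (hx1 : x < 1) {z : ℂ} (h0 : 0 ≤ z.re) (h1 : z.re ≤ 1)
    (hz : z ≠ x) : Complex.cos (Real.pi * z) ≠ Complex.cos (Real.pi * x) := by
  intro h
  have hpi : (Real.pi : ℂ) ≠ 0 := by exact_mod_cast Real.pi_ne_zero
  obtain ⟨k, hk | hk⟩ := Complex.cos_eq_cos_iff.1 h
  · have e : (x : ℂ) = 2 * k + z := mul_left_cancel₀ hpi (by linear_combination hk)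
    have e2 : x = 2 * k + z.re := by simpa using congrArg Complex.re e
    have k1 : (k : ℝ) < 1 := by linarith
    have k2 : (-1 : ℝ) < k := by linarith
    have : k = 0 := by
      have a : k < 1 := by exact_mod_cast k1
      have b : -1 < k := by exact_mod_cast k2
      omega
    rw [this] at e
    exact hz (by simp [e])
  · have e : (x : ℂ) = 2 * k - z := mul_left_cancel₀ hpi (by linear_combination hk)
    have e2 : x = 2 * k - z.re := by simpa using congrArg Complex.re e
    have k1 : (k : ℝ) < 1 := by linarith
    have k2 : (0 : ℝ) < k := by linarith
    have a : k < 1 := by exact_mod_cast k1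
    have b : 0 < k := by exact_mod_cast k2
    omega

/-- The difference quotient of `z ↦ cos (π z)` at `x`. -/
def cosSlope (x : ℝ) : ℂ → ℂ := dslope (fun z : ℂ => Complex.cos (Real.pi * z)) x

lemma differentiable_cosSlope (x : ℝ) : Differentiable ℂ (cosSlope x) := by
  rw [← differentiableOn_univ, cosSlope, Complex.differentiableOn_dslope univ_mem]
  fun_prop

lemma cosSlope_of_ne {x : ℝ} {z : ℂ} (hz : z ≠ x) :
    cosSlope x z = (Complex.cos (Real.pi * z) - Complex.cos (Real.pi * x)) / (z - x) := by
  rw [cosSlope, dslope_of_ne _ hz, slope_def_field]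

/-- Away from `x` this is the injectivity statement `cos_pi_mul_ne`; at `x` the slope is the
derivative `-π sin πx`. Hence dividing by the slope creates no pole in the closed strip. -/
lemma cosSlope_ne_zero {x : ℝ} (hx0 : 0 < x) (hx1 : x < 1) {z : ℂ} (h0 : 0 ≤ z.re)
    (h1 : z.re ≤ 1) : cosSlope x z ≠ 0 := by
  by_cases hz : z = x
  · have hd : HasDerivAt (fun z : ℂ => Complex.cos (Real.pi * z))
        (-Complex.sin (Real.pi * x) * (Real.pi * 1)) x :=
      ((hasDerivAt_id (x : ℂ)).const_mul (Real.pi : ℂ)).ccos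
    rw [hz, cosSlope, dslope_same, hd.deriv]
    have h2 : 0 < Real.sin (Real.pi * x) :=
      Real.sin_pos_of_pos_of_lt_pi (by positivity) (by nlinarith [Real.pi_pos])
    have h3 : Complex.sin (Real.pi * x) ≠ 0 := by
      rw [← Complex.ofReal_mul, ← Complex.ofReal_sin]; exact_mod_cast h2.ne'
    simp [h3]
  · rw [cosSlope_of_ne hz]
    exact div_ne_zero (sub_ne_zero.2 (cos_pi_mul_ne hx0 hx1 h0 h1 hz)) (sub_ne_zero.2 hz)

/-- The integrand of the Poisson formula at the point `x` of the strip. -/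
def poissonIntegrand (f : ℂ → Ell2) (x : ℝ) (z : ℂ) : Ell2 :=
  (cosSlope x z)⁻¹ • dslope f x z

/-- The factors `z - x` of the two difference quotients cancel. Writing the integrand as a ratio of
difference quotients removes the singularity at `x`, so no residue has to be computed. -/
lemma poissonIntegrand_of_ne (f : ℂ → Ell2) {x : ℝ} {z : ℂ} (hz : z ≠ x) :
    poissonIntegrand f x z =
      (Complex.cos (Real.pi * z) - Complex.cos (Real.pi * x))⁻¹ • (f z - f x) := by
  have h : z - x ≠ 0 := sub_ne_zero.2 hz
  rw [poissonIntegrand, cosSlope_of_ne hz, dslope_of_ne _ hz, slope_def_module, smul_smul, inv_div,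
    div_mul_eq_mul_div, mul_inv_cancel₀ h, one_div]

lemma mem_strip_ofReal {x : ℝ} (hx0 : 0 < x) (hx1 : x < 1) : (x : ℂ) ∈ strip := ⟨hx0, hx1⟩

lemma continuousOn_poissonIntegrand {f : ℂ → Ell2} (hf : DiffContOnCl ℂ f strip) {x : ℝ}
    (hx0 : 0 < x) (hx1 : x < 1) : ContinuousOn (poissonIntegrand f x) (closure strip) := by
  have hx := mem_strip_ofReal hx0 hx1
  refine ((differentiable_cosSlope x).continuous.continuousOn.inv₀ fun z hz => ?_).smul ?_
  · rw [closure_strip] at hz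
    exact cosSlope_ne_zero hx0 hx1 hz.1 hz.2
  · exact (continuousOn_dslope (mem_of_superset (isOpen_strip.mem_nhds hx) subset_closure)).2
      ⟨hf.continuousOn, hf.differentiableAt isOpen_strip hx⟩

lemma differentiableOn_poissonIntegrand {f : ℂ → Ell2} (hf : DiffContOnCl ℂ f strip) {x : ℝ}
    (hx0 : 0 < x) (hx1 : x < 1) : DifferentiableOn ℂ (poissonIntegrand f x) strip := by
  have hx := mem_strip_ofReal hx0 hx1
  refine ((differentiable_cosSlope x).differentiableOn.inv fun z hz => ?_).smul ?_
  · exact cosSlope_ne_zero hx0 hx1 hz.1.le hz.2.le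
  · exact (Complex.differentiableOn_dslope (isOpen_strip.mem_nhds hx)).2 hf.differentiableOn

/-- Cauchy's theorem on the rectangle with corners `-iT` and `1 + iT`. Continuity up to the boundary
is enough for the vertical sides to lie on the boundary lines themselves. -/
lemma rect_poissonIntegrand {f : ℂ → Ell2} (hf : DiffContOnCl ℂ f strip) {x : ℝ}
    (hx0 : 0 < x) (hx1 : x < 1) (T : ℝ) :
    (∫ u : ℝ in (0 : ℝ)..1, poissonIntegrand f x (u + (-T : ℝ) * Complex.I)) -
      (∫ u : ℝ in (0 : ℝ)..1, poissonIntegrand f x (u + T * Complex.I)) +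
      Complex.I • (∫ y : ℝ in -T..T, poissonIntegrand f x ((1 : ℝ) + y * Complex.I)) -
      Complex.I • (∫ y : ℝ in -T..T, poissonIntegrand f x ((0 : ℝ) + y * Complex.I)) = 0 := by
  have := Complex.integral_boundary_rect_eq_zero_of_continuousOn_of_differentiableOn
    (poissonIntegrand f x) (⟨0, -T⟩ : ℂ) (⟨1, T⟩ : ℂ)
    ((continuousOn_poissonIntegrand hf hx0 hx1).mono ?_)
    ((differentiableOn_poissonIntegrand hf hx0 hx1).mono ?_)
  · exact this
  · rintro z ⟨hz, -⟩
    rw [closure_strip]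
    rw [Set.mem_preimage, Set.uIcc_of_le zero_le_one] at hz
    exact hz
  · rintro z ⟨hz, -⟩
    rw [Set.mem_preimage, min_eq_left zero_le_one, max_eq_right zero_le_one] at hz
    exact hz

/-! ### Decay on the horizontal sides and passage to the limit -/

lemma sinh_le_norm_cos (u y : ℝ) : |Real.sinh y| ≤ ‖Complex.cos (u + y * Complex.I)‖ := by
  rw [Complex.cos_add_mul_I, ← Complex.ofReal_cos, ← Complex.ofReal_cosh, ← Complex.ofReal_sin,
    ← Complex.ofReal_sinh, ← Complex.ofReal_mul, ← Complex.ofReal_mul]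
  refine abs_le_of_sq_le_sq ?_ (norm_nonneg _)
  have e : ‖(↑(Real.cos u * Real.cosh y) - ↑(Real.sin u * Real.sinh y) * Complex.I : ℂ)‖ ^ 2 =
      (Real.cos u * Real.cosh y) ^ 2 + (Real.sin u * Real.sinh y) ^ 2 := by
    rw [← Complex.normSq_eq_norm_sq, Complex.normSq_apply]
    simp [-Complex.ofReal_cos, -Complex.ofReal_sin, -Complex.ofReal_cosh, -Complex.ofReal_sinh]
    ring
  rw [e]
  have := Real.cosh_sq y
  have h2 := Real.sin_sq_add_cos_sq u
  nlinarith [sq_nonneg (Real.cos u)]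

lemma norm_poissonIntegrand_le {f : ℂ → Ell2} {M : ℝ} (hM : ∀ z ∈ closure strip, ‖f z‖ ≤ M)
    {x : ℝ} (hx0 : 0 < x) (hx1 : x < 1) {u y : ℝ} (hu0 : 0 ≤ u) (hu1 : u ≤ 1)
    (hy : 1 < |Real.sinh (Real.pi * y)|) :
    ‖poissonIntegrand f x (u + y * Complex.I)‖ ≤ 2 * M / (|Real.sinh (Real.pi * y)| - 1) := by
  have hne : (u + y * Complex.I : ℂ) ≠ x := by
    intro h
    have := congrArg Complex.im h
    have hy0 : y = 0 := by simpa using this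
    simp [hy0] at hy
    linarith
  rw [poissonIntegrand_of_ne _ hne, norm_smul, norm_inv, inv_mul_eq_div]
  have h1 : ‖f (u + y * Complex.I) - f x‖ ≤ 2 * M := by
    refine (norm_sub_le _ _).trans ?_
    have a := hM (u + y * Complex.I) (by rw [closure_strip]; simp [hu0, hu1])
    have b := hM x (subset_closure (mem_strip_ofReal hx0 hx1))
    linarith
  have h2 : |Real.sinh (Real.pi * y)| - 1 ≤
      ‖Complex.cos (Real.pi * (u + y * Complex.I)) - Complex.cos (Real.pi * x)‖ := by
    have a := sinh_le_norm_cos (Real.pi * u) (Real.pi * y)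
    have e : ((Real.pi * u : ℝ) : ℂ) + ((Real.pi * y : ℝ) : ℂ) * Complex.I =
      Real.pi * (u + y * Complex.I) := by push_cast; ring
    rw [e] at a
    have b : ‖Complex.cos (Real.pi * x)‖ ≤ 1 := by
      rw [← Complex.ofReal_mul, ← Complex.ofReal_cos, Complex.norm_real]
      exact Real.abs_cos_le_one _
    have c := norm_sub_norm_le (Complex.cos (Real.pi * (u + y * Complex.I)))
      (Complex.cos (Real.pi * x))
    linarith
  exact div_le_div₀ ((norm_nonneg _).trans h1) h1 (by linarith) h2

lemma tendsto_horizontal {f : ℂ → Ell2} {M : ℝ} (hM : ∀ z ∈ closure strip, ‖f z‖ ≤ M)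
    {x : ℝ} (hx0 : 0 < x) (hx1 : x < 1) {l : Filter ℝ} {y : ℝ → ℝ}
    (hy : Tendsto (fun T => |Real.sinh (Real.pi * y T)|) l atTop) :
    Tendsto (fun T => ∫ u : ℝ in (0 : ℝ)..1, poissonIntegrand f x (u + y T * Complex.I)) l
      (𝓝 0) := by
  have h : Tendsto (fun T => 2 * M / (|Real.sinh (Real.pi * y T)| - 1)) l (𝓝 0) :=
    Tendsto.div_atTop tendsto_const_nhds (tendsto_atTop_add_const_right _ _ hy)
  refine squeeze_zero_norm' ?_ h
  filter_upwards [hy.eventually_gt_atTop 1] with T hT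
  refine (intervalIntegral.norm_integral_le_of_norm_le_const (C :=
    2 * M / (|Real.sinh (Real.pi * y T)| - 1)) fun u hu => ?_).trans (by simp)
  rw [Set.uIoc_of_le zero_le_one] at hu
  exact norm_poissonIntegrand_le hM hx0 hx1 hu.1.le hu.2 hT

lemma tendsto_abs_sinh : Tendsto (fun T => |Real.sinh (Real.pi * T)|) atTop atTop := by
  refine tendsto_abs_atTop_atTop.comp (Tendsto.comp (g := Real.sinh) ?_
    (tendsto_id.const_mul_atTop Real.pi_pos))
  refine tendsto_atTop_mono' _ ?_ tendsto_id
  filter_upwards [eventually_ge_atTop 0] with t ht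
  exact Real.self_le_sinh_iff.2 ht

/-- The parametrization of the vertical line through `x`. -/
def line (x t : ℝ) : ℂ := (x : ℂ) + (t : ℂ) * Complex.I

lemma continuous_line (x : ℝ) : Continuous (line x) := by
  unfold line; fun_prop

lemma line_zero_mem (t : ℝ) : line 0 t ∈ closure strip := by
  rw [closure_strip]; simp [line]

lemma line_one_mem (t : ℝ) : line 1 t ∈ closure strip := by
  rw [closure_strip]; simp [line]

lemma IsBddHol.continuous_line_zero {f : ℂ → Ell2} (hf : IsBddHol f) :
    Continuous fun t => f (line 0 t) :=
  hf.1.continuousOn.comp_continuous (continuous_line 0) line_zero_mem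

lemma IsBddHol.continuous_line_one {f : ℂ → Ell2} (hf : IsBddHol f) :
    Continuous fun t => f (line 1 t) :=
  hf.1.continuousOn.comp_continuous (continuous_line 1) line_one_mem

lemma integrable_smul_of_bounded {k : ℝ → ℝ} (hk : Integrable k) {g : ℝ → Ell2}
    (hg : Continuous g) {M : ℝ} (hM : ∀ t, ‖g t‖ ≤ M) : Integrable fun t => k t • g t :=
  hk.smul_of_top_left (memLp_top_of_bound hg.aestronglyMeasurable M (ae_of_all _ hM))

lemma coe_smul_ell2 (r : ℝ) (v : Ell2) : (r : ℂ) • v = r • v := by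
  ext i; rfl

lemma poissonIntegrand_line_zero (f : ℂ → Ell2) {x : ℝ} (hx0 : 0 < x) (t : ℝ) :
    poissonIntegrand f x (line 0 t) =
      (1 / (Real.cosh (Real.pi * t) - Real.cos (Real.pi * x))) • (f (line 0 t) - f x) := by
  rw [poissonIntegrand_of_ne, ← coe_smul_ell2]
  · congr 1
    have : (Real.pi : ℂ) * line 0 t = ((Real.pi * t : ℝ) : ℂ) * Complex.I := by
      simp [line]; ring
    rw [this, Complex.cos_mul_I]
    push_cast
    rw [one_div]
  · intro h
    have := congrArg Complex.re h
    simp [line] at this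
    linarith

/-- On this line `cos πz = -cosh πt`. The resulting minus sign turns the difference of the two
vertical integrals in Cauchy's theorem into the sum in the Poisson formula. -/
lemma poissonIntegrand_line_one (f : ℂ → Ell2) {x : ℝ} (hx1 : x < 1) (t : ℝ) :
    poissonIntegrand f x (line 1 t) =
      -((1 / (Real.cosh (Real.pi * t) + Real.cos (Real.pi * x))) • (f (line 1 t) - f x)) := by
  rw [poissonIntegrand_of_ne, ← coe_smul_ell2, ← neg_smul]
  · congr 1
    have : (Real.pi : ℂ) * line 1 t = ((Real.pi * t : ℝ) : ℂ) * Complex.I + Real.pi := by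
      simp [line]; ring
    rw [this, Complex.cos_add_pi, Complex.cos_mul_I]
    push_cast
    rw [one_div, ← inv_neg]
    congr 1
    ring
  · intro h
    have := congrArg Complex.re h
    simp [line] at this
    linarith

lemma sin_pi_mul_pos {x : ℝ} (hx0 : 0 < x) (hx1 : x < 1) : 0 < Real.sin (Real.pi * x) :=
  Real.sin_pos_of_pos_of_lt_pi (by positivity) (by nlinarith [Real.pi_pos])

lemma integrable_poissonKernel_zero {x : ℝ} (hx0 : 0 < x) (hx1 : x < 1) :
    Integrable fun t : ℝ => 1 / (Real.cosh (Real.pi * t) - Real.cos (Real.pi * x)) :=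
  integrable_cosh_sub (sin_pi_mul_pos hx0 hx1) (Real.sin_sq_add_cos_sq _)

lemma integrable_poissonKernel_one {x : ℝ} (hx0 : 0 < x) (hx1 : x < 1) :
    Integrable fun t : ℝ => 1 / (Real.cosh (Real.pi * t) + Real.cos (Real.pi * x)) := by
  have := integrable_cosh_sub (c := -Real.cos (Real.pi * x)) (sin_pi_mul_pos hx0 hx1)
    (by rw [neg_sq, Real.sin_sq_add_cos_sq])
  simpa only [sub_neg_eq_add] using this

/-- The Poisson formula at a real point of the strip. -/
theorem IsBddHol.poisson {f : ℂ → Ell2} (hf : IsBddHol f) {x : ℝ} (hx0 : 0 < x) (hx1 : x < 1) :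
    f x = (Real.sin (Real.pi * x) / 2) •
      ((∫ t : ℝ, (1 / (Real.cosh (Real.pi * t) - Real.cos (Real.pi * x))) • f (line 0 t)) +
        ∫ t : ℝ, (1 / (Real.cosh (Real.pi * t) + Real.cos (Real.pi * x))) • f (line 1 t)) := by
  obtain ⟨M, hM⟩ := hf.2
  have hk0 := integrable_poissonKernel_zero hx0 hx1
  have hk1 := integrable_poissonKernel_one hx0 hx1
  have i0 := integrable_smul_of_bounded hk0 hf.continuous_line_zero fun t => hM _ (line_zero_mem t)
  have i1 := integrable_smul_of_bounded hk1 hf.continuous_line_one fun t => hM _ (line_one_mem t)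
  have j0 : Integrable fun t => poissonIntegrand f x (line 0 t) := by
    simp only [poissonIntegrand_line_zero f hx0, smul_sub]
    exact i0.sub (hk0.smul_const _)
  have j1 : Integrable fun t => poissonIntegrand f x (line 1 t) := by
    simp only [poissonIntegrand_line_one f hx1, smul_sub]
    exact (i1.sub (hk1.smul_const _)).neg
  have hlim := (((tendsto_horizontal hM hx0 hx1 (l := atTop) (y := fun T => -T) (by
    simpa [Real.sinh_neg] using tendsto_abs_sinh)).sub
    (tendsto_horizontal hM hx0 hx1 (y := fun T => T) tendsto_abs_sinh)).add
    ((intervalIntegral_tendsto_integral j1 tendsto_neg_atTop_atBot tendsto_id).const_smul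
      Complex.I)).sub
    ((intervalIntegral_tendsto_integral j0 tendsto_neg_atTop_atBot tendsto_id).const_smul Complex.I)
  have h0 := tendsto_nhds_unique (hlim.congr fun T => rect_poissonIntegrand hf.1 hx0 hx1 T)
    tendsto_const_nhds
  -- The horizontal sides have disappeared, so the two vertical integrals agree. Collecting the
  -- terms with `f x` produces the total mass `2 / sin πx` of the kernels.
  rw [sub_self, zero_add, ← smul_sub, smul_eq_zero_iff_right Complex.I_ne_zero, sub_eq_zero] at h0
  simp only [poissonIntegrand_line_zero f hx0, poissonIntegrand_line_one f hx1, smul_sub] at h0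
  rw [integral_neg, integral_sub i1 (hk1.smul_const _), integral_sub i0 (hk0.smul_const _),
    integral_smul_const, integral_smul_const, neg_sub, sub_eq_sub_iff_add_eq_add, ← add_smul,
    add_comm (∫ t : ℝ, 1 / (Real.cosh (Real.pi * t) + _)),
    integral_cosh_add_integral_cosh (sin_pi_mul_pos hx0 hx1) (Real.sin_sq_add_cos_sq _)] at h0
  rw [← h0, smul_smul]
  have := (sin_pi_mul_pos hx0 hx1).ne'
  rw [show Real.sin (Real.pi * x) / 2 * (2 / Real.sin (Real.pi * x)) = 1 by field_simp, one_smul]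

/-! ### The measures on the boundary lines -/

lemma integrable_inv_cosh : Integrable fun t : ℝ => 1 / Real.cosh (Real.pi * t) := by
  simpa using integrable_cosh_sub (s := 1) (c := 0) one_pos (by norm_num)

lemma integral_inv_cosh : ∫ t : ℝ, 1 / Real.cosh (Real.pi * t) = 1 := by
  have := integral_cosh_add_integral_cosh (s := 1) (c := 0) one_pos (by norm_num)
  simp only [sub_zero, add_zero] at this
  linarith

lemma measurable_density : Measurable fun t : ℝ => ENNReal.ofReal (1 / Real.cosh (Real.pi * t)) :=
  (Continuous.measurable (continuous_const.div (by fun_prop)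
    fun t => (Real.cosh_pos _).ne')).ennreal_ofReal

lemma lineMeasure_eq (x : ℝ) : lineMeasure x = ((volume : Measure ℝ).withDensity
    (fun t => ENNReal.ofReal (1 / Real.cosh (Real.pi * t)))).map (line x) := rfl

lemma measurableEmbedding_line (x : ℝ) : MeasurableEmbedding (line x) := by
  refine (continuous_line x).measurableEmbedding fun s t h => ?_
  simpa [line] using congrArg Complex.im h

instance (x : ℝ) : IsProbabilityMeasure (lineMeasure x) := by
  constructor
  rw [lineMeasure_eq, (measurableEmbedding_line x).map_apply, Set.preimage_univ,
    withDensity_apply _ MeasurableSet.univ, Measure.restrict_univ,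
    ← ofReal_integral_eq_lintegral_ofReal integrable_inv_cosh
      (ae_of_all _ fun t => (one_div_pos.2 (Real.cosh_pos _)).le), integral_inv_cosh,
    ENNReal.ofReal_one]

lemma ae_lineMeasure {x : ℝ} {p : ℂ → Prop} (h : ∀ t, p (line x t)) : ∀ᵐ z ∂lineMeasure x, p z := by
  rw [lineMeasure_eq, (measurableEmbedding_line x).ae_map_iff]
  exact ae_of_all _ h

lemma integral_lineMeasure {G : Type*} [NormedAddCommGroup G] [NormedSpace ℝ G] (x : ℝ)
    (F : ℂ → G) :
    ∫ z, F z ∂lineMeasure x = ∫ t, (1 / Real.cosh (Real.pi * t)) • F (line x t) := by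
  rw [lineMeasure_eq, (measurableEmbedding_line x).integral_map,
    integral_withDensity_eq_integral_toReal_smul measurable_density
      (ae_of_all _ fun t => ENNReal.ofReal_lt_top)]
  refine integral_congr_ae (ae_of_all _ fun t => ?_)
  simp only
  rw [ENNReal.toReal_ofReal (one_div_pos.2 (Real.cosh_pos _)).le]

lemma memLp_lineMeasure {x : ℝ} {f : ℂ → Ell2} (hf : Continuous fun t => f (line x t)) {M : ℝ}
    (hM : ∀ t, ‖f (line x t)‖ ≤ M) : MemLp f 2 (lineMeasure x) := by
  refine MemLp.of_bound ?_ M (ae_lineMeasure hM)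
  rw [lineMeasure_eq, (measurableEmbedding_line x).aestronglyMeasurable_map_iff]
  exact hf.aestronglyMeasurable

lemma IsBddHol.memLp_zero {f : ℂ → Ell2} (hf : IsBddHol f) : MemLp f 2 (lineMeasure 0) := by
  obtain ⟨M, hM⟩ := hf.2
  exact memLp_lineMeasure hf.continuous_line_zero fun t => hM _ (line_zero_mem t)

lemma IsBddHol.memLp_one {f : ℂ → Ell2} (hf : IsBddHol f) : MemLp f 2 (lineMeasure 1) := by
  obtain ⟨M, hM⟩ := hf.2
  exact memLp_lineMeasure hf.continuous_line_one fun t => hM _ (line_one_mem t)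

lemma IsBddHol.exists_bdry {f : ℂ → Ell2} (hf : IsBddHol f) : ∃ b, IsBdryValue f b :=
  ⟨(hf.memLp_zero.toLp f, hf.memLp_one.toLp f), hf.memLp_zero.coeFn_toLp, hf.memLp_one.coeFn_toLp⟩

lemma norm_sq_Lp {x : ℝ} {g : Lp Ell2 2 (lineMeasure x)} {f : ℂ → Ell2}
    (h : (g : ℂ → Ell2) =ᵐ[lineMeasure x] f) : ‖g‖ ^ 2 = ∫ z, ‖f z‖ ^ 2 ∂lineMeasure x := by
  have h1 : inner ℂ g g = ∫ z, inner ℂ (g z) (g z) ∂lineMeasure x := L2.inner_def g g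
  simp only [inner_self_eq_norm_sq_to_K] at h1
  have h2 : ((‖g‖ ^ 2 : ℝ) : ℂ) = ((∫ z, ‖g z‖ ^ 2 ∂lineMeasure x : ℝ) : ℂ) := by
    rw [← integral_complex_ofReal]; simpa using h1
  rw [Complex.ofReal_inj.1 h2]
  exact integral_congr_ae (h.mono fun z hz => by simp only [hz])

lemma sq_integral_norm_le {x : ℝ} {f : ℂ → Ell2} (hf : MemLp f 2 (lineMeasure x)) :
    (∫ z, ‖f z‖ ∂lineMeasure x) ^ 2 ≤ ∫ z, ‖f z‖ ^ 2 ∂lineMeasure x := by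
  have h1 : Integrable (fun z => ‖f z‖) (lineMeasure x) :=
    (hf.integrable one_le_two).norm
  have h2 : Integrable (fun z => ‖f z‖ ^ 2) (lineMeasure x) := hf.norm.integrable_sq
  exact (convexOn_pow 2).map_integral_le (continuous_pow 2).continuousOn isClosed_Ici
    (ae_of_all _ fun z => norm_nonneg (f z)) h1 h2

lemma integral_norm_le_Lp {x : ℝ} {g : Lp Ell2 2 (lineMeasure x)} {f : ℂ → Ell2}
    (h : (g : ℂ → Ell2) =ᵐ[lineMeasure x] f) : ∫ z, ‖f z‖ ∂lineMeasure x ≤ ‖g‖ := by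
  have hf : MemLp f 2 (lineMeasure x) := (memLp_congr_ae h).1 (Lp.memLp g)
  refine (sq_le_sq₀ (integral_nonneg fun z => norm_nonneg _) (norm_nonneg g)).1 ?_
  rw [norm_sq_Lp h]
  exact sq_integral_norm_le hf

/-- The Poisson formula at the point `1 / 2`. -/
lemma IsBddHol.poisson_half {f : ℂ → Ell2} (hf : IsBddHol f) :
    f (1 / 2) = (1 / 2 : ℝ) • ((∫ z, f z ∂lineMeasure 0) + ∫ z, f z ∂lineMeasure 1) := by
  have h := hf.poisson (x := 1 / 2) (by norm_num) (by norm_num)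
  have e : Real.pi * (1 / 2) = Real.pi / 2 := by ring
  rw [e, Real.sin_pi_div_two, Real.cos_pi_div_two] at h
  simp only [sub_zero, add_zero] at h
  rw [integral_lineMeasure, integral_lineMeasure, ← h]
  norm_num

/-- The Poisson formula at `1 / 2` is an average of two means over probability measures: apply
Jensen on each line, then convexity of the square to the two means. -/
lemma IsBddHol.norm_sq_half_le {f : ℂ → Ell2} (hf : IsBddHol f) :
    ‖f (1 / 2)‖ ^ 2 ≤
      ((∫ z, ‖f z‖ ^ 2 ∂lineMeasure 0) + ∫ z, ‖f z‖ ^ 2 ∂lineMeasure 1) / 2 := by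
  have h0 := sq_integral_norm_le hf.memLp_zero
  have h1 := sq_integral_norm_le hf.memLp_one
  have h : ‖f (1 / 2)‖ ≤
      ((∫ z, ‖f z‖ ∂lineMeasure 0) + ∫ z, ‖f z‖ ∂lineMeasure 1) / 2 := by
    rw [hf.poisson_half, norm_smul]
    have a := norm_add_le (∫ z, f z ∂lineMeasure 0) (∫ z, f z ∂lineMeasure 1)
    have b := norm_integral_le_integral_norm (μ := lineMeasure 0) f
    have c := norm_integral_le_integral_norm (μ := lineMeasure 1) f
    rw [Real.norm_of_nonneg (by norm_num)]
    linarith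
  have h2 := pow_le_pow_left₀ (norm_nonneg _) h 2
  nlinarith [sq_nonneg ((∫ z, ‖f z‖ ∂lineMeasure 0) - ∫ z, ‖f z‖ ∂lineMeasure 1)]

/-! ### Local bounds in the strip -/

lemma IsBddHol.translate {f : ℂ → Ell2} (hf : IsBddHol f) (y : ℝ) :
    IsBddHol fun z => f (z + y * Complex.I) := by
  have hm : Set.MapsTo (fun z : ℂ => z + y * Complex.I) strip strip := fun z hz => by
    simpa [strip] using hz
  have hm' : Set.MapsTo (fun z : ℂ => z + y * Complex.I) (closure strip) (closure strip) :=
    fun z hz => by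
      rw [closure_strip] at hz ⊢
      simpa using hz
  obtain ⟨M, hM⟩ := hf.2
  refine ⟨hf.1.comp (Differentiable.diffContOnCl (by fun_prop)) hm, M, fun z hz => hM _ (hm' hz)⟩

/-- Addition formula together with `|sinh| ≤ cosh` and `cosh b + sinh |b| = e^{|b|}`. It compares
the weight `1 / cosh` with its translates. -/
lemma cosh_le_mul_cosh (a b : ℝ) : Real.cosh a ≤ Real.exp |b| * Real.cosh (a - b) := by
  have h : Real.cosh a = Real.cosh (a - b) * Real.cosh b + Real.sinh (a - b) * Real.sinh b := by
    rw [← Real.cosh_add]; ring_nf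
  have h1 : |Real.sinh (a - b)| ≤ Real.cosh (a - b) :=
    abs_le_of_sq_le_sq (by rw [Real.cosh_sq]; linarith) (Real.cosh_pos _).le
  have h2 : Real.sinh (a - b) * Real.sinh b ≤ Real.cosh (a - b) * Real.sinh |b| := by
    rw [← Real.abs_sinh]
    refine (le_abs_self _).trans ?_
    rw [abs_mul]
    gcongr
  rw [h, ← Real.cosh_add_sinh, Real.cosh_abs]
  linarith

lemma integral_translate_le {g : ℝ → ℝ} (hg : Continuous g) (hg0 : ∀ t, 0 ≤ g t) {M : ℝ}
    (hM : ∀ t, g t ≤ M) (y : ℝ) :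
    ∫ t, 1 / Real.cosh (Real.pi * t) * g (t + y) ≤
      Real.exp (Real.pi * |y|) * ∫ t, 1 / Real.cosh (Real.pi * t) * g t := by
  have hi : Integrable fun t => 1 / Real.cosh (Real.pi * t) * g t :=
    integrable_inv_cosh.mul_bdd hg.aestronglyMeasurable
      (ae_of_all _ fun t => by rw [Real.norm_of_nonneg (hg0 t)]; exact hM t)
  rw [← integral_const_mul, ← integral_sub_right_eq_self _ y]
  refine integral_mono_of_nonneg (ae_of_all _ fun t =>
    mul_nonneg (one_div_pos.2 (Real.cosh_pos _)).le (hg0 _)) (hi.const_mul _)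
    (ae_of_all _ fun t => ?_)
  simp only [sub_add_cancel]
  rw [← mul_assoc]
  refine mul_le_mul_of_nonneg_right ?_ (hg0 t)
  rw [mul_one_div, div_le_div_iff₀ (Real.cosh_pos _) (Real.cosh_pos _), one_mul]
  have := cosh_le_mul_cosh (Real.pi * t) (Real.pi * y)
  rwa [abs_mul, abs_of_pos Real.pi_pos, ← mul_sub] at this

/-- The constant in the bound of an analytic function by its boundary values. -/
def stripBound (w : ℂ) : ℝ :=
  1 / (1 - |Real.cos (Real.pi * w.re)|) * Real.exp (Real.pi * |w.im|)

lemma abs_cos_lt_one {x : ℝ} (hx0 : 0 < x) (hx1 : x < 1) : |Real.cos (Real.pi * x)| < 1 := by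
  have h := Real.sin_sq_add_cos_sq (Real.pi * x)
  have := sin_pi_mul_pos hx0 hx1
  rw [abs_lt]
  constructor <;> nlinarith

lemma stripBound_pos {w : ℂ} (hw : w ∈ strip) : 0 < stripBound w :=
  mul_pos (one_div_pos.2 (sub_pos.2 (abs_cos_lt_one hw.1 hw.2))) (Real.exp_pos _)

lemma continuousOn_stripBound : ContinuousOn stripBound strip := by
  unfold stripBound
  refine ContinuousOn.mul (ContinuousOn.div continuousOn_const (by fun_prop) fun w hw => ?_)
    (by fun_prop)
  exact (sub_pos.2 (abs_cos_lt_one hw.1 hw.2)).ne'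

/-- Because `cosh ≥ 1`, `cosh - c ≥ cosh - C ≥ (1 - C) cosh`. This compares every Poisson kernel
with the kernel at `1 / 2`, which is the density of the boundary measures. -/
lemma kernel_le {c C : ℝ} (hc : |c| ≤ C) (hC : C < 1) (t : ℝ) :
    1 / (Real.cosh (Real.pi * t) - c) ≤ 1 / (1 - C) * (1 / Real.cosh (Real.pi * t)) := by
  have h1 := Real.one_le_cosh (Real.pi * t)
  have hc' := (le_abs_self c).trans hc
  have hC0 : 0 ≤ C := (abs_nonneg c).trans hc
  rw [one_div_mul_one_div]
  refine one_div_le_one_div_of_le (mul_pos (by linarith) (by linarith)) ?_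
  nlinarith

lemma norm_integral_kernel_le {c C : ℝ} (hc : |c| ≤ C) (hC : C < 1) {g : ℝ → Ell2}
    (hg : Continuous g) {M : ℝ} (hM : ∀ t, ‖g t‖ ≤ M) :
    ‖∫ t : ℝ, (1 / (Real.cosh (Real.pi * t) - c)) • g t‖ ≤
      1 / (1 - C) * ∫ t, 1 / Real.cosh (Real.pi * t) * ‖g t‖ := by
  rw [← integral_const_mul]
  refine norm_integral_le_of_norm_le (Integrable.const_mul (integrable_inv_cosh.mul_bdd
    hg.norm.aestronglyMeasurable (ae_of_all _ fun t => by rw [norm_norm]; exact hM t)) _)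
    (ae_of_all _ fun t => ?_)
  rw [norm_smul, ← mul_assoc, Real.norm_of_nonneg
    (one_div_pos.2 (cosh_sub_pos (((le_abs_self c).trans hc).trans_lt hC) t)).le]
  exact mul_le_mul_of_nonneg_right (kernel_le hc hC t) (norm_nonneg _)

lemma IsBddHol.norm_ofReal_le {f : ℂ → Ell2} (hf : IsBddHol f) {x : ℝ} (hx0 : 0 < x)
    (hx1 : x < 1) :
    ‖f x‖ ≤ 1 / (1 - |Real.cos (Real.pi * x)|) *
      ((∫ t, 1 / Real.cosh (Real.pi * t) * ‖f (line 0 t)‖) +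
        ∫ t, 1 / Real.cosh (Real.pi * t) * ‖f (line 1 t)‖) := by
  obtain ⟨M, hM⟩ := hf.2
  have hC := abs_cos_lt_one hx0 hx1
  have h0 := norm_integral_kernel_le (c := Real.cos (Real.pi * x)) le_rfl hC
    hf.continuous_line_zero fun t => hM _ (line_zero_mem t)
  have h1 := norm_integral_kernel_le (c := -Real.cos (Real.pi * x)) (abs_neg _).le hC
    hf.continuous_line_one fun t => hM _ (line_one_mem t)
  simp only [sub_neg_eq_add] at h1
  rw [hf.poisson hx0 hx1, norm_smul, Real.norm_of_nonneg (by
    have := sin_pi_mul_pos hx0 hx1; positivity), mul_add]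
  refine (mul_le_of_le_one_left (norm_nonneg _) ?_).trans ((norm_add_le _ _).trans
    (add_le_add h0 h1))
  linarith [Real.sin_le_one (Real.pi * x)]

/-- A vertical translation moves `w` to the real point `w.re`. The two factors of `stripBound` are
the comparison of kernels there and the cost of translating the weight back. -/
lemma IsBddHol.norm_le {f : ℂ → Ell2} (hf : IsBddHol f) {w : ℂ} (hw : w ∈ strip) :
    ‖f w‖ ≤ stripBound w *
      ((∫ z, ‖f z‖ ∂lineMeasure 0) + ∫ z, ‖f z‖ ∂lineMeasure 1) := by
  obtain ⟨M, hM⟩ := hf.2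
  have h := (hf.translate w.im).norm_ofReal_le hw.1 hw.2
  rw [Complex.re_add_im] at h
  have e : ∀ x t : ℝ, line x t + w.im * Complex.I = line x (t + w.im) := fun x t => by
    simp only [line]; push_cast; ring
  simp only [e] at h
  refine h.trans ?_
  rw [stripBound, mul_assoc, integral_lineMeasure, integral_lineMeasure]
  have h0 : 0 < 1 - |Real.cos (Real.pi * w.re)| := sub_pos.2 (abs_cos_lt_one hw.1 hw.2)
  refine mul_le_mul_of_nonneg_left ?_ (one_div_pos.2 h0).le
  rw [mul_add]
  exact add_le_add
    (integral_translate_le (g := fun t => ‖f (line 0 t)‖) hf.continuous_line_zero.norm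
      (fun t => norm_nonneg _) (fun t => hM _ (line_zero_mem t)) _)
    (integral_translate_le (g := fun t => ‖f (line 1 t)‖) hf.continuous_line_one.norm
      (fun t => norm_nonneg _) (fun t => hM _ (line_one_mem t)) _)

lemma IsBddHol.norm_le_bdry {f : ℂ → Ell2} (hf : IsBddHol f) {b : L2left × L2right}
    (hb : IsBdryValue f b) {w : ℂ} (hw : w ∈ strip) : ‖f w‖ ≤ stripBound w * (2 * ‖b‖) := by
  refine (hf.norm_le hw).trans (mul_le_mul_of_nonneg_left ?_ (stripBound_pos hw).le)
  have h0 := (integral_norm_le_Lp hb.1).trans (norm_fst_le b)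
  have h1 := (integral_norm_le_Lp hb.2).trans (norm_snd_le b)
  linarith

/-! ### Analytic extensions -/

lemma IsAnalyticExtension.norm_le {f : ℂ → Ell2} {g : L2left × L2right}
    (h : IsAnalyticExtension f g) {w : ℂ} (hw : w ∈ strip) : ‖f w‖ ≤ stripBound w * (2 * ‖g‖) := by
  obtain ⟨-, F, b, hF, hb, hu⟩ := h
  exact le_of_tendsto_of_tendsto' (hu.tendsto_at hw).norm
    ((hb.norm.const_mul 2).const_mul (stripBound w)) fun k => (hF k).1.norm_le_bdry (hF k).2 hw

lemma IsAnalyticExtension.sub {f f' : ℂ → Ell2} {g g' : L2left × L2right}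
    (h : IsAnalyticExtension f g) (h' : IsAnalyticExtension f' g') :
    IsAnalyticExtension (f - f') (g - g') := by
  have := h.add (h'.smul (-1))
  rwa [neg_one_smul, neg_one_smul, ← sub_eq_add_neg, ← sub_eq_add_neg] at this

/-- The difference of two extensions extends the boundary function `0`, and the local bound forces
it to vanish. -/
lemma IsAnalyticExtension.eqOn {f f' : ℂ → Ell2} {g : L2left × L2right}
    (h : IsAnalyticExtension f g) (h' : IsAnalyticExtension f' g) : Set.EqOn f' f strip := by
  intro w hw
  have := (h'.sub h).norm_le hw
  rw [sub_self, norm_zero, mul_zero, mul_zero] at this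
  exact sub_eq_zero.1 (norm_le_zero_iff.1 this)

lemma IsBddHol.isAnalyticExtension {f : ℂ → Ell2} (hf : IsBddHol f) {b : L2left × L2right}
    (hb : IsBdryValue f b) : IsAnalyticExtension f b :=
  ⟨hf.1.differentiableOn, fun _ => f, fun _ => b, fun _ => ⟨hf, hb⟩, tendsto_const_nhds,
    fun _ hu _ _ => ⟨Set.univ, univ_mem, Eventually.of_forall fun _ _ _ => refl_mem_uniformity hu⟩⟩

lemma IsBddHol.norm_sub_le_bdry {f f' : ℂ → Ell2} (hf : IsBddHol f) (hf' : IsBddHol f')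
    {b b' : L2left × L2right} (hb : IsBdryValue f b) (hb' : IsBdryValue f' b') {w : ℂ}
    (hw : w ∈ strip) : ‖f w - f' w‖ ≤ stripBound w * (2 * ‖b - b'‖) :=
  ((hf.isAnalyticExtension hb).sub (hf'.isAnalyticExtension hb')).norm_le hw

/-- By the local bound, `L₂` convergence of boundary values makes the approximating functions Cauchy
at each point, with a rate governed by `stripBound`. Since `stripBound` is continuous, hence locally
bounded, the convergence is locally uniform and the limit is holomorphic. -/
theorem exists_isAnalyticExtension {g : L2left × L2right} (hg : g ∈ hardy) :
    ∃ f, IsAnalyticExtension f g := by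
  obtain ⟨b, hbm, hb⟩ := mem_closure_iff_seq_limit.1
    (show g ∈ closure (bddHolBdry : Set (L2left × L2right)) from hg)
  choose F hF hFb using hbm
  have hdist : ∀ k l, ∀ w ∈ strip, ‖F k w - F l w‖ ≤ stripBound w * (2 * ‖b k - b l‖) :=
    fun k l w hw => (hF k).norm_sub_le_bdry (hF l) (hFb k) (hFb l) hw
  have hlim : ∀ w ∈ strip, ∃ v, Tendsto (fun k => F k w) atTop (𝓝 v) := by
    intro w hw
    refine cauchySeq_tendsto_of_complete (Metric.cauchySeq_iff.2 fun ε hε => ?_)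
    have hK : 0 < stripBound w * 2 := mul_pos (stripBound_pos hw) two_pos
    obtain ⟨N, hN⟩ := Metric.cauchySeq_iff.1 hb.cauchySeq (ε / (stripBound w * 2)) (by positivity)
    refine ⟨N, fun k hk l hl => ?_⟩
    rw [dist_eq_norm]
    refine (hdist k l w hw).trans_lt ?_
    have := hN k hk l hl
    rw [dist_eq_norm, lt_div_iff₀ hK] at this
    linarith
  choose! f hf using hlim
  have hdist' : ∀ k, ∀ w ∈ strip, ‖F k w - f w‖ ≤ stripBound w * (2 * ‖b k - g‖) :=
    fun k w hw => le_of_tendsto_of_tendsto' ((hf w hw).const_sub (F k w)).norm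
      (((hb.const_sub (b k)).norm.const_mul 2).const_mul (stripBound w)) fun l => hdist k l w hw
  have hu : TendstoLocallyUniformlyOn F f atTop strip := by
    rw [Metric.tendstoLocallyUniformlyOn_iff]
    intro ε hε w hw
    have hK : 0 < (stripBound w + 1) * 2 := by have := stripBound_pos hw; positivity
    have h0 : Tendsto (fun k => ‖b k - g‖) atTop (𝓝 0) := tendsto_iff_norm_sub_tendsto_zero.1 hb
    -- On this neighbourhood of `w` the constant of the pointwise estimate stays below `stripBound w
    -- + 1`.
    refine ⟨{z | stripBound z < stripBound w + 1} ∩ strip, inter_mem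
      ((continuousOn_stripBound w hw).eventually_lt continuousWithinAt_const (lt_add_one _))
      self_mem_nhdsWithin, ?_⟩
    filter_upwards [h0.eventually_lt_const (show 0 < ε / ((stripBound w + 1) * 2) by positivity)]
      with k hk z hz
    rw [dist_comm, dist_eq_norm]
    refine (hdist' k z hz.2).trans_lt ?_
    rw [lt_div_iff₀ hK] at hk
    have h1 : stripBound z * (2 * ‖b k - g‖) ≤ (stripBound w + 1) * (2 * ‖b k - g‖) :=
      mul_le_mul_of_nonneg_right (le_of_lt hz.1) (by positivity)
    linarith
  exact ⟨f, hu.differentiableOn (Eventually.of_forall fun k => (hF k).1.differentiableOn)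
    isOpen_strip, F, b, fun k => ⟨hF k, hFb k⟩, hb, hu⟩

lemma half_mem_strip : (1 / 2 : ℂ) ∈ strip := by
  norm_num [strip]

/-- The value at `1 / 2` of the analytic extension. -/
def evalHalf : hardy →ₗ[ℂ] Ell2 where
  toFun g := (exists_isAnalyticExtension g.2).choose (1 / 2)
  map_add' g g' := ((exists_isAnalyticExtension g.2).choose_spec.add
    (exists_isAnalyticExtension g'.2).choose_spec).eqOn
      (exists_isAnalyticExtension (g + g').2).choose_spec half_mem_strip
  map_smul' a g := ((exists_isAnalyticExtension g.2).choose_spec.smul a).eqOn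
      (exists_isAnalyticExtension (a • g).2).choose_spec half_mem_strip

lemma evalHalf_eq {g : hardy} {f : ℂ → Ell2} (h : IsAnalyticExtension f (g : L2left × L2right)) :
    evalHalf g = f (1 / 2) :=
  h.eqOn (exists_isAnalyticExtension g.2).choose_spec half_mem_strip

lemma norm_evalHalf_le (g : hardy) : ‖evalHalf g‖ ≤ stripBound (1 / 2) * 2 * ‖g‖ := by
  rw [mul_assoc]
  exact (exists_isAnalyticExtension g.2).choose_spec.norm_le half_mem_strip

lemma continuous_evalHalf : Continuous evalHalf :=
  AddMonoidHomClass.continuous_of_bound evalHalf _ norm_evalHalf_le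

/-- `N` asks for some extension vanishing at `1 / 2`; by uniqueness this is the same as vanishing of
the chosen one. -/
lemma ker_evalHalf : LinearMap.ker evalHalf = hardyVanishing := by
  ext g
  rw [LinearMap.mem_ker]
  obtain ⟨f, hf⟩ := exists_isAnalyticExtension g.2
  constructor
  · intro h
    exact ⟨f, hf, by rw [← evalHalf_eq hf, h]⟩
  · rintro ⟨f', hf', h0⟩
    rw [evalHalf_eq hf', h0]

lemma bddHolBdry_le_hardy : bddHolBdry ≤ hardy := Submodule.le_topologicalClosure _

/-- Constant functions belong to the Hardy space. -/
lemma surjective_evalHalf : Function.Surjective evalHalf := by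
  intro v
  have hf : IsBddHol fun _ => v := ⟨diffContOnCl_const, ‖v‖, fun _ _ => le_rfl⟩
  obtain ⟨b, hb⟩ := hf.exists_bdry
  exact ⟨⟨b, bddHolBdry_le_hardy ⟨_, hf, hb⟩⟩, evalHalf_eq (hf.isAnalyticExtension hb)⟩

/-- The isomorphism `G / N → ℓ₂` induced by the evaluation at `1 / 2`. -/
def quotEquiv : (hardy ⧸ hardyVanishing) ≃ₗ[ℂ] Ell2 :=
  (Submodule.quotEquivOfEq _ _ ker_evalHalf.symm).trans
    (evalHalf.quotKerEquivOfSurjective surjective_evalHalf)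

lemma quotEquiv_mkQ (g : hardy) : quotEquiv (hardyVanishing.mkQ g) = evalHalf g := rfl

/-! ### Row and column norms -/

section RowCol

variable {H : Type*} [NormedAddCommGroup H] [InnerProductSpace ℂ H] {n : ℕ}

/-- The quadratic form of a column: `‖∑ j, v j • x · j‖²`. -/
def colQ (x : Matrix (Fin n) (Fin n) H) (v : Fin n → ℂ) : ℝ := ∑ i, ‖∑ j, v j • x i j‖ ^ 2

lemma colQ_nonneg (x : Matrix (Fin n) (Fin n) H) (v : Fin n → ℂ) : 0 ≤ colQ x v :=
  Finset.sum_nonneg fun _ _ => sq_nonneg _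

lemma blockOperator_apply {X Y : Type*} [NormedAddCommGroup X] [NormedSpace ℂ X]
    [NormedAddCommGroup Y] [NormedSpace ℂ Y] (T : Matrix (Fin n) (Fin n) (X →L[ℂ] Y))
    (v : PiLp 2 (fun _ : Fin n => X)) (i : Fin n) :
    blockOperator T v i = ∑ j, T i j (v j) := by
  simp [blockOperator]

lemma colNorms_le_iff (x : Matrix (Fin n) (Fin n) H) {c : ℝ} (hc : 0 ≤ c) :
    colNorms H n x ≤ c ↔ ∀ v, colQ x v ≤ c ^ 2 * ∑ j, ‖v j‖ ^ 2 := by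
  have key : ∀ v : PiLp 2 (fun _ : Fin n => ℂ),
      ‖blockOperator (x.map fun v : H => ContinuousLinearMap.toSpanSingleton ℂ v) v‖ ^ 2 =
        colQ x v := by
    intro v
    rw [PiLp.norm_sq_eq_of_L2]
    simp [blockOperator_apply, colQ]
  rw [colNorms, inducedNorms, ContinuousLinearMap.opNorm_le_iff hc]
  constructor
  · intro h v
    have := pow_le_pow_left₀ (norm_nonneg _) (h (WithLp.toLp 2 v)) 2
    rwa [key, mul_pow, PiLp.norm_sq_eq_of_L2] at this
  · intro h v
    refine (sq_le_sq₀ (norm_nonneg _) (by positivity)).1 ?_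
    rw [key, mul_pow, PiLp.norm_sq_eq_of_L2]
    exact h v

lemma colNorms_nonneg (x : Matrix (Fin n) (Fin n) H) : 0 ≤ colNorms H n x := by
  unfold colNorms inducedNorms; positivity

lemma rowNorms_nonneg (x : Matrix (Fin n) (Fin n) H) : 0 ≤ rowNorms H n x := by
  unfold rowNorms inducedNorms; positivity

lemma colNorms_map {H' : Type*} [NormedAddCommGroup H'] [InnerProductSpace ℂ H']
    (e : H →ₗᵢ[ℂ] H') (x : Matrix (Fin n) (Fin n) H) :
    colNorms H' n (x.map e) = colNorms H n x := by
  have h : ∀ v, colQ (x.map e) v = colQ x v := fun v =>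
    Finset.sum_congr rfl fun i _ => by
      rw [← e.norm_map, map_sum]; simp
  refine le_antisymm ?_ ?_
  · rw [colNorms_le_iff _ (colNorms_nonneg _)]
    simpa only [h] using (colNorms_le_iff x (colNorms_nonneg _)).1 le_rfl
  · rw [colNorms_le_iff _ (colNorms_nonneg _)]
    simpa only [h] using (colNorms_le_iff (x.map e) (colNorms_nonneg _)).1 le_rfl

lemma norm_sum_mul_sq_le (v w : Fin n → ℂ) :
    ‖∑ i, v i * w i‖ ^ 2 ≤ (∑ i, ‖v i‖ ^ 2) * ∑ i, ‖w i‖ ^ 2 := by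
  refine (pow_le_pow_left₀ (norm_nonneg _) (norm_sum_le _ _) 2).trans ?_
  simp only [norm_mul]
  exact Finset.sum_mul_sq_le_sq_mul_sq _ _ _

/-- Pairing the output of the row operator with a scalar vector `v` moves `v` onto the matrix: `∑
v_i ξ_j(x_ij) = ∑ ξ_j(∑ v_i x_ij)`. The row operator thus has the norm of the transposed column
operator. The functionals `⟨y, ·⟩` suffice as test vectors, so `H` need not be complete. -/
lemma rowNorms_le_iff (x : Matrix (Fin n) (Fin n) H) {c : ℝ} (hc : 0 ≤ c) :
    rowNorms H n x ≤ c ↔ ∀ v, colQ x.transpose v ≤ c ^ 2 * ∑ j, ‖v j‖ ^ 2 := by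
  have key : ∀ (ξ : PiLp 2 (fun _ : Fin n => StrongDual ℂ H)) i,
      blockOperator (x.map fun v : H => NormedSpace.inclusionInDoubleDual ℂ H v) ξ i =
        ∑ j, ξ j (x i j) := fun ξ i => by
    simp [blockOperator_apply]
  have pair : ∀ (ξ : PiLp 2 (fun _ : Fin n => StrongDual ℂ H)) (v : Fin n → ℂ),
      ∑ i, v i * ∑ j, ξ j (x i j) = ∑ j, ξ j (∑ i, v i • x i j) := fun ξ v => by
    simp only [Finset.mul_sum, map_sum, map_smul, smul_eq_mul]
    exact Finset.sum_comm
  rw [rowNorms, inducedNorms, ContinuousLinearMap.opNorm_le_iff hc]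
  constructor
  · intro h v
    set y : Fin n → H := fun j => ∑ i, v i • x i j with hy
    have hQ : colQ x.transpose v = ∑ j, ‖y j‖ ^ 2 := rfl
    -- This is the extremal choice. With `Q = ∑ ‖y j‖²`, both the pairing and `‖ξ‖²` equal `Q`, so
    -- `Q² ≤ ‖v‖² c² Q`, and one factor `Q` cancels unless it is zero.
    set ξ : PiLp 2 (fun _ : Fin n => StrongDual ℂ H) := WithLp.toLp 2 fun j => innerSL ℂ (y j)
    have h1 := pow_le_pow_left₀ (norm_nonneg _) (h ξ) 2
    rw [mul_pow, PiLp.norm_sq_eq_of_L2, PiLp.norm_sq_eq_of_L2] at h1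
    simp only [key] at h1
    have hξ : ∑ j, ‖ξ j‖ ^ 2 = colQ x.transpose v := by
      rw [hQ]
      exact Finset.sum_congr rfl fun j _ => by
        rw [show ξ j = innerSL ℂ (y j) from rfl, innerSL_apply_norm]
    have h2 := norm_sum_mul_sq_le v fun i => ∑ j, ξ j (x i j)
    rw [pair] at h2
    have h3 : ∑ j, ξ j (∑ i, v i • x i j) = ((colQ x.transpose v : ℝ) : ℂ) := by
      rw [hQ]
      push_cast
      refine Finset.sum_congr rfl fun j _ => ?_
      exact inner_self_eq_norm_sq_to_K (y j)
    rw [h3, Complex.norm_real, Real.norm_of_nonneg (colQ_nonneg _ _)] at h2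
    rw [hξ] at h1
    rcases (colQ_nonneg x.transpose v).eq_or_lt with h0 | h0
    · rw [← h0]; positivity
    · refine le_of_mul_le_mul_right ?_ h0
      have h4 : (0 : ℝ) ≤ ∑ i, ‖v i‖ ^ 2 := by positivity
      nlinarith [mul_le_mul_of_nonneg_left h1 h4]
  · intro h ξ
    refine (sq_le_sq₀ (norm_nonneg _) (by positivity)).1 ?_
    rw [mul_pow]
    set w : Fin n → ℂ := fun i => ∑ j, ξ j (x i j) with hw
    set N : ℝ := ∑ i, ‖w i‖ ^ 2 with hN
    have hN0 : 0 ≤ N := by positivity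
    have e1 : ‖blockOperator (x.map fun v : H => NormedSpace.inclusionInDoubleDual ℂ H v) ξ‖ ^ 2 =
        N := by
      rw [PiLp.norm_sq_eq_of_L2]; simp only [key, hN, hw]
    rw [e1]
    -- The conjugate of the output `w` makes the pairing equal to `‖w‖²`, which is then bounded by
    -- Cauchy–Schwarz and the hypothesis on the form.
    set v : Fin n → ℂ := fun i => star (w i) with hv
    have h2 : (N : ℂ) = ∑ j, ξ j (∑ i, v i • x i j) := by
      rw [← pair, hN]
      push_cast
      refine Finset.sum_congr rfl fun i _ => ?_
      change _ = star (w i) * w i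
      rw [Complex.star_def, Complex.conj_mul']
    have h3 : N ^ 2 ≤ ‖ξ‖ ^ 2 * colQ x.transpose v := by
      have : N = ‖∑ j, ξ j (∑ i, v i • x i j)‖ := by
        rw [← h2, Complex.norm_real, Real.norm_of_nonneg hN0]
      rw [PiLp.norm_sq_eq_of_L2]
      nth_rewrite 1 [this]
      refine (pow_le_pow_left₀ (norm_nonneg _) ((norm_sum_le _ _).trans
        (Finset.sum_le_sum fun j _ => (ξ j).le_opNorm _)) 2).trans ?_
      exact Finset.sum_mul_sq_le_sq_mul_sq _ _ _
    have h4 := h v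
    have h5 : ∑ j, ‖v j‖ ^ 2 = N := by simp [hv, hN]
    rw [h5] at h4
    rcases hN0.eq_or_lt with h0 | h0
    · rw [← h0]; positivity
    · refine le_of_mul_le_mul_right ?_ h0
      nlinarith [mul_le_mul_of_nonneg_left h4 (sq_nonneg ‖ξ‖)]

lemma rowNorms_eq (x : Matrix (Fin n) (Fin n) H) : rowNorms H n x = colNorms H n x.transpose := by
  refine le_antisymm ?_ ?_
  · rw [rowNorms_le_iff _ (colNorms_nonneg _), ← colNorms_le_iff _ (colNorms_nonneg _)]
  · rw [colNorms_le_iff _ (rowNorms_nonneg _), ← rowNorms_le_iff _ (rowNorms_nonneg _)]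

lemma rowNorms_map {H' : Type*} [NormedAddCommGroup H'] [InnerProductSpace ℂ H']
    (e : H →ₗᵢ[ℂ] H') (x : Matrix (Fin n) (Fin n) H) :
    rowNorms H' n (x.map e) = rowNorms H n x := by
  rw [rowNorms_eq, rowNorms_eq, ← colNorms_map e, Matrix.transpose_map]

end RowCol

lemma bdryNorms_le_iff {n : ℕ} (x : Matrix (Fin n) (Fin n) (L2left × L2right)) {c : ℝ}
    (hc : 0 ≤ c) :
    bdryNorms n x ≤ c ↔ (∀ v, colQ (x.map Prod.fst).transpose v ≤ c ^ 2 * ∑ j, ‖v j‖ ^ 2) ∧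
      ∀ v, colQ (x.map Prod.snd) v ≤ c ^ 2 * ∑ j, ‖v j‖ ^ 2 := by
  rw [bdryNorms, sumNorms, max_le_iff, rowNorms_le_iff _ hc, colNorms_le_iff _ hc]

lemma bdryNorms_nonneg {n : ℕ} (x : Matrix (Fin n) (Fin n) (L2left × L2right)) :
    0 ≤ bdryNorms n x := le_max_of_le_left (rowNorms_nonneg _)

/-! ### Identification of the spaces with `ℓ₂` -/

instance : TopologicalSpace.SeparableSpace Ell2 := by
  have b : HilbertBasis ℕ ℂ Ell2 := ⟨LinearIsometryEquiv.refl ℂ Ell2⟩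
  rw [← TopologicalSpace.isSeparable_univ_iff]
  have h := ((Set.countable_range b).isSeparable.span (R := ℂ)).closure
  rwa [← Submodule.topologicalClosure_coe, b.dense_span, Submodule.top_coe] at h

instance (x : ℝ) : TopologicalSpace.SeparableSpace (Lp Ell2 2 (lineMeasure x)) := by
  have : Fact ((2 : ENNReal) ≠ ⊤) := ⟨by simp⟩
  infer_instance

theorem exists_linearIsometryEquiv_ell2 (K : Type*) [NormedAddCommGroup K] [InnerProductSpace ℂ K]
    [CompleteSpace K] [TopologicalSpace.SeparableSpace K] (hK : ¬ FiniteDimensional ℂ K) :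
    Nonempty (K ≃ₗᵢ[ℂ] Ell2) := by
  obtain ⟨w, b, hb⟩ := exists_hilbertBasis ℂ K
  have hinf : Infinite w := by
    by_contra hfin
    rw [not_infinite_iff_finite] at hfin
    have := Fintype.ofFinite w
    exact hK b.toOrthonormalBasis.toBasis.finiteDimensional_of_finite
  have hcount : Countable w := by
    -- Distinct orthonormal vectors are at distance `√2 > 1`, so the balls of radius `1 / 2` around
    -- them are disjoint; separability allows only countably many.
    refine Set.countable_univ_iff.1 (Set.PairwiseDisjoint.countable_of_isOpen
      (s := fun i : w => Metric.ball (b i) (1 / 2)) (fun i _ j _ hij => ?_)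
      (fun i _ => Metric.isOpen_ball) fun i _ => ⟨b i, Metric.mem_ball_self (by norm_num)⟩)
    refine Metric.ball_disjoint_ball ?_
    rw [dist_eq_norm]
    have h := norm_sub_sq (𝕜 := ℂ) (b i) (b j)
    rw [b.orthonormal.2 hij, b.orthonormal.1, b.orthonormal.1] at h
    norm_num at h ⊢
    nlinarith [norm_nonneg (b i - b j)]
  obtain ⟨e⟩ : Nonempty (ℕ ≃ w) := nonempty_equiv_of_countable
  have hsp : ⊤ ≤ (Submodule.span ℂ (Set.range (b ∘ e))).topologicalClosure := by
    rw [e.surjective.range_comp, b.dense_span]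
  exact ⟨(HilbertBasis.mk (b.orthonormal.comp e e.injective) hsp).repr⟩

lemma not_finiteDimensional_ell2 : ¬ FiniteDimensional ℂ Ell2 := by
  intro h
  have b : HilbertBasis ℕ ℂ Ell2 := ⟨LinearIsometryEquiv.refl ℂ Ell2⟩
  exact not_finite_iff_infinite.2 (inferInstance : Infinite ℕ)
    b.orthonormal.linearIndependent.finite

/-- The measure is a probability measure, so constants embed `ℓ₂` isometrically. -/
lemma not_finiteDimensional_Lp (x : ℝ) : ¬ FiniteDimensional ℂ (Lp Ell2 2 (lineMeasure x)) := by
  intro h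
  refine not_finiteDimensional_ell2 (FiniteDimensional.of_injective
    (Lp.constₗ (E := Ell2) 2 (lineMeasure x) ℂ) fun u v huv => ?_)
  have h1 : ∀ c : Ell2, ‖Lp.const 2 (lineMeasure x) c‖ = ‖c‖ := fun c => by
    refine (Lp.norm_const (p := 2) (μ := lineMeasure x) (c := c) two_ne_zero).trans ?_
    simp
  have h2 : ‖Lp.const 2 (lineMeasure x) (u - v)‖ = 0 := by
    rw [map_sub, sub_eq_zero.2 (by simpa using huv), norm_zero]
  rw [h1] at h2
  exact sub_eq_zero.1 (norm_eq_zero.1 h2)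

/-- Any Hilbert space isometry is completely isometric for both the row and the column structure, so
it is enough to identify each boundary `L₂` space with `ℓ₂` as a Hilbert space. -/
theorem exists_isometry_bdry : ∃ (e₀ : L2left ≃ₗᵢ[ℂ] Ell2) (e₁ : L2right ≃ₗᵢ[ℂ] Ell2),
    IsCompletelyIsometric bdryNorms rowPlusCol
      (LinearEquiv.prodCongr e₀.toLinearEquiv e₁.toLinearEquiv) := by
  obtain ⟨e₀⟩ := exists_linearIsometryEquiv_ell2 L2left (not_finiteDimensional_Lp 0)
  obtain ⟨e₁⟩ := exists_linearIsometryEquiv_ell2 L2right (not_finiteDimensional_Lp 1)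
  refine ⟨e₀, e₁, fun n x => ?_⟩
  rw [bdryNorms, rowPlusCol, sumNorms, sumNorms, ← rowNorms_map e₀.toLinearIsometry,
    ← colNorms_map e₁.toLinearIsometry]
  rfl

/-! ### Matrix coefficients -/

section Hat

open scoped ComplexOrder
open Matrix

variable {n : ℕ}

/-- The matrix `Uᵀ y conj(P)`, transposed. -/
def hat {M : Type*} [AddCommGroup M] [Module ℂ M] (U P : Matrix (Fin n) (Fin n) ℂ)
    (y : Matrix (Fin n) (Fin n) M) (s t : Fin n) : M :=
  ∑ i, ∑ j, (U i t * star (P j s)) • y i j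

lemma lft_eq_hat (U P : Matrix (Fin n) (Fin n) ℂ) (y : Matrix (Fin n) (Fin n) Ell2) (s t : Fin n) :
    lft U P y s t = hat U P y s t := rfl

lemma map_hat {M M' : Type*} [AddCommGroup M] [Module ℂ M] [AddCommGroup M'] [Module ℂ M']
    (f : M →ₗ[ℂ] M') (U P : Matrix (Fin n) (Fin n) ℂ) (y : Matrix (Fin n) (Fin n) M)
    (s t : Fin n) : f (hat U P y s t) = hat U P (y.map f) s t := by
  simp [hat, map_sum]

lemma inner_self_ofReal {H : Type*} [NormedAddCommGroup H] [InnerProductSpace ℂ H] (v : H) :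
    inner ℂ v v = ((‖v‖ : ℝ) : ℂ) ^ 2 := by
  rw [inner_self_eq_norm_sq_to_K]; rfl

lemma sum_norm_sq_unitary {H : Type*} [NormedAddCommGroup H] [InnerProductSpace ℂ H]
    {P : Matrix (Fin n) (Fin n) ℂ} (hP : P * Pᴴ = 1) (z : Fin n → H) :
    ∑ s, ‖∑ j, P j s • z j‖ ^ 2 = ∑ j, ‖z j‖ ^ 2 := by
  have h : ((∑ s, ‖∑ j, P j s • z j‖ ^ 2 : ℝ) : ℂ) = ((∑ j, ‖z j‖ ^ 2 : ℝ) : ℂ) := by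
    push_cast
    simp only [← inner_self_ofReal]
    calc ∑ s, inner ℂ (∑ j, P j s • z j) (∑ j, P j s • z j)
        = ∑ j, ∑ l, (P * Pᴴ) l j * inner ℂ (z j) (z l) := by
          have h : ∀ s, inner ℂ (∑ j, P j s • z j) (∑ j, P j s • z j) =
              ∑ j, ∑ l, P l s * star (P j s) * inner ℂ (z j) (z l) := fun s => by
            rw [sum_inner]
            refine Finset.sum_congr rfl fun j _ => ?_
            rw [inner_sum]
            refine Finset.sum_congr rfl fun l _ => ?_
            rw [inner_smul_left, inner_smul_right, starRingEnd_apply]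
            ring
          simp only [h, mul_apply, Finset.sum_mul, conjTranspose_apply]
          rw [Finset.sum_comm]
          refine Finset.sum_congr rfl fun j _ => ?_
          rw [Finset.sum_comm]
      _ = ∑ j, inner ℂ (z j) (z j) := by
          rw [hP]
          refine Finset.sum_congr rfl fun j _ => ?_
          rw [Finset.sum_eq_single j (fun l _ hl => by rw [one_apply_ne hl, zero_mul])
            (fun h => absurd (Finset.mem_univ j) h), one_apply_eq, one_mul]
  exact_mod_cast h

lemma map_star_mul_conjTranspose {P : Matrix (Fin n) (Fin n) ℂ} (hP : P * Pᴴ = 1) :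
    P.map star * (P.map star)ᴴ = 1 := by
  have := congrArg (fun A : Matrix (Fin n) (Fin n) ℂ => A.map (starRingEnd ℂ)) hP
  simp only [Matrix.map_mul, Matrix.map_one _ (map_zero _) (map_one _)] at this
  exact this

/-- Summing over `s` removes the unitary `P`, and only the `t`-th column of `U` is left as a test
vector. Row norms therefore control the coefficients summed over `s`; `sum_hat_col` does the same
for column norms with the sum over `t`. -/
lemma sum_hat_row {H : Type*} [NormedAddCommGroup H] [InnerProductSpace ℂ H]
    (U : Matrix (Fin n) (Fin n) ℂ) {P : Matrix (Fin n) (Fin n) ℂ} (hP : P * Pᴴ = 1)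
    (y : Matrix (Fin n) (Fin n) H) (t : Fin n) :
    ∑ s, ‖hat U P y s t‖ ^ 2 = colQ yᵀ fun i => U i t := by
  rw [colQ]
  refine Eq.trans ?_ (sum_norm_sq_unitary (map_star_mul_conjTranspose hP) _)
  refine Finset.sum_congr rfl fun s _ => ?_
  congr 2
  unfold hat
  rw [Finset.sum_comm]
  refine Finset.sum_congr rfl fun j _ => ?_
  rw [Finset.smul_sum]
  refine Finset.sum_congr rfl fun i _ => ?_
  rw [smul_smul, mul_comm]; rfl

lemma sum_hat_col {H : Type*} [NormedAddCommGroup H] [InnerProductSpace ℂ H]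
    {U : Matrix (Fin n) (Fin n) ℂ} (hU : U * Uᴴ = 1) (P : Matrix (Fin n) (Fin n) ℂ)
    (y : Matrix (Fin n) (Fin n) H) (s : Fin n) :
    ∑ t, ‖hat U P y s t‖ ^ 2 = colQ y fun j => star (P j s) := by
  rw [colQ]
  refine Eq.trans ?_ (sum_norm_sq_unitary hU _)
  refine Finset.sum_congr rfl fun t _ => ?_
  congr 2
  unfold hat
  refine Finset.sum_congr rfl fun j _ => ?_
  rw [Finset.smul_sum]
  refine Finset.sum_congr rfl fun i _ => ?_
  rw [smul_smul]

lemma sum_norm_sq_column {U : Matrix (Fin n) (Fin n) ℂ} (hU : Uᴴ * U = 1) (t : Fin n) :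
    ∑ i, ‖U i t‖ ^ 2 = 1 := by
  have h := congrFun (congrFun hU t) t
  rw [mul_apply, one_apply_eq] at h
  have : ((∑ i, ‖U i t‖ ^ 2 : ℝ) : ℂ) = (1 : ℝ) := by
    rw [Complex.ofReal_one, ← h]
    push_cast
    refine Finset.sum_congr rfl fun i _ => ?_
    rw [conjTranspose_apply, Complex.star_def, Complex.conj_mul']
  exact_mod_cast this

/-- The matrix `U diag(α) U*`. -/
def conjDiag (U : Matrix (Fin n) (Fin n) ℂ) (α : Fin n → ℝ) : Matrix (Fin n) (Fin n) ℂ :=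
  U * diagonal (fun i => (α i : ℂ)) * Uᴴ

/-- At positive matrices in spectral form the Gram form becomes a weighted sum of squares of the
coefficients. This converts statements about `OH` into scalar estimates for each coefficient. -/
lemma gramForm_conjDiag (x : Matrix (Fin n) (Fin n) Ell2) (U P : Matrix (Fin n) (Fin n) ℂ)
    (α β : Fin n → ℝ) :
    gramForm x x (conjDiag U α) (conjDiag P β) =
      ((∑ s, ∑ t, α t * β s * ‖hat U P x s t‖ ^ 2 : ℝ) : ℂ) := by
  rw [conjDiag, conjDiag, Matrix.mul_assoc, Matrix.mul_assoc, gramForm_mul]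
  push_cast
  refine Finset.sum_congr rfl fun s _ => Finset.sum_congr rfl fun t _ => ?_
  have e : lft (diagonal (fun i => (α i : ℂ)) * Uᴴ)ᴴ (diagonal (fun i => (β i : ℂ)) * Pᴴ)ᴴ x s t =
      (α t * β s : ℂ) • lft U P x s t := by
    simp only [lft, Finset.smul_sum, smul_smul, conjTranspose_mul, conjTranspose_conjTranspose,
      diagonal_conjTranspose, mul_diagonal, Pi.star_apply, star_mul', Complex.star_def,
      Complex.conj_ofReal]
    refine Finset.sum_congr rfl fun i _ => Finset.sum_congr rfl fun j _ => ?_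
    congr 1
    ring
  rw [e, inner_smul_right, inner_self_eq_norm_sq_to_K, lft_eq_hat]
  rfl

lemma frob_conjDiag {U : Matrix (Fin n) (Fin n) ℂ} (hU : Uᴴ * U = 1) (α : Fin n → ℝ) :
    frob (conjDiag U α) = ∑ i, α i ^ 2 := by
  have : ((frob (conjDiag U α) : ℝ) : ℂ) = ((∑ i, α i ^ 2 : ℝ) : ℂ) := by
    set D : Matrix (Fin n) (Fin n) ℂ := diagonal (fun i => (α i : ℂ)) with hD
    have e : conjDiag U α * (conjDiag U α)ᴴ = U * (D * Dᴴ * Uᴴ) := by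
      rw [conjDiag, conjTranspose_mul, conjTranspose_mul, conjTranspose_conjTranspose]
      calc _ = U * (D * (Uᴴ * U) * Dᴴ * Uᴴ) := by simp only [Matrix.mul_assoc, hD]
        _ = _ := by rw [hU, Matrix.mul_one]
    rw [frob_eq_trace, e, Matrix.trace_mul_comm, Matrix.mul_assoc, hU, Matrix.mul_one, hD,
      diagonal_conjTranspose, diagonal_mul_diagonal, trace_diagonal]
    push_cast
    refine Finset.sum_congr rfl fun i _ => ?_
    simp [sq]
  exact_mod_cast this

lemma exists_conjDiag {A : Matrix (Fin n) (Fin n) ℂ} (hA : A.PosSemidef) :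
    ∃ (U : Matrix (Fin n) (Fin n) ℂ) (α : Fin n → ℝ), U * Uᴴ = 1 ∧ Uᴴ * U = 1 ∧ (∀ i, 0 ≤ α i) ∧
      A = conjDiag U α :=
  ⟨hA.1.eigenvectorUnitary, hA.1.eigenvalues,
    (Matrix.mem_unitaryGroup_iff).1 hA.1.eigenvectorUnitary.2,
    (Matrix.mem_unitaryGroup_iff').1 hA.1.eigenvectorUnitary.2, hA.eigenvalues_nonneg,
    hA.1.spectral_theorem⟩

/-- For unitary `U`, `P`: the coefficients are controlled by the norm of the Gram matrix. -/
lemma sum_hat_le (x : Matrix (Fin n) (Fin n) Ell2) {U P : Matrix (Fin n) (Fin n) ℂ}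
    (hU : Uᴴ * U = 1) (hP : Pᴴ * P = 1) (α β : Fin n → ℝ) :
    ∑ s, ∑ t, α t * β s * ‖hat U P x s t‖ ^ 2 ≤
      matNorm (gram x x) * (√(∑ i, α i ^ 2) * √(∑ i, β i ^ 2)) := by
  have h := norm_gramForm_le x x (conjDiag U α) (conjDiag P β)
  rw [gramForm_conjDiag, frob_conjDiag hU, frob_conjDiag hP, Complex.norm_real] at h
  exact (le_abs_self _).trans h

/-- The hypothesis, by the spectral theorem, bounds the form at pairs `(RRᴴ, PPᴴ)`. Arbitrary pairs
reduce to these by a Cauchy–Schwarz inequality of Haagerup type. -/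
lemma matNorm_gram_le_of_conjDiag {x : Matrix (Fin n) (Fin n) Ell2} {c : ℝ} (hc : 0 ≤ c)
    (h : ∀ (U P : Matrix (Fin n) (Fin n) ℂ) (α β : Fin n → ℝ), U * Uᴴ = 1 → Uᴴ * U = 1 →
      P * Pᴴ = 1 → Pᴴ * P = 1 → (∀ i, 0 ≤ α i) → (∀ i, 0 ≤ β i) →
      ∑ s, ∑ t, α t * β s * ‖hat U P x s t‖ ^ 2 ≤ c * (√(∑ i, α i ^ 2) * √(∑ i, β i ^ 2))) :
    matNorm (gram x x) ≤ c := by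
  have hps : ∀ R P : Matrix (Fin n) (Fin n) ℂ, ∑ s, ∑ t, ‖lft R P x s t‖ ^ 2 ≤
      c * (√(frob (R * Rᴴ)) * √(frob (P * Pᴴ))) := by
    intro R P
    have h1 := gramForm_mul x x R Rᴴ P Pᴴ
    rw [conjTranspose_conjTranspose, conjTranspose_conjTranspose] at h1
    have h2 : gramForm x x (R * Rᴴ) (P * Pᴴ) = ((∑ s, ∑ t, ‖lft R P x s t‖ ^ 2 : ℝ) : ℂ) := by
      rw [h1]; push_cast
      refine Finset.sum_congr rfl fun s _ => Finset.sum_congr rfl fun t _ => ?_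
      rw [inner_self_eq_norm_sq_to_K]; rfl
    obtain ⟨U, α, hU, hU', hα, hA⟩ := exists_conjDiag (posSemidef_self_mul_conjTranspose R)
    obtain ⟨V, β, hV, hV', hβ, hB⟩ := exists_conjDiag (posSemidef_self_mul_conjTranspose P)
    rw [hA, hB, gramForm_conjDiag] at h2
    rw [← Complex.ofReal_inj.1 h2, hA, hB, frob_conjDiag hU', frob_conjDiag hV']
    exact h U V α β hU hU' hV hV' hα hβ
  -- Each argument is split as `W = RT`, `V = PQ`, where `RRᴴ`, `TᴴT` have the Hilbert–Schmidt norm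
  -- of `W` and `PPᴴ`, `QᴴQ` that of `V`. Cauchy–Schwarz then separates `(R, P)` from `(T, Q)`
  -- without loss.
  refine matNorm_le_of_gramForm hc fun W V => ?_
  obtain ⟨R, T, hW, hR, hT⟩ := exists_factor W
  obtain ⟨P, Q, hV, hP, hQ⟩ := exists_factor V
  have e1 := hps R P
  have e2 := hps Tᴴ Qᴴ
  rw [conjTranspose_conjTranspose, conjTranspose_conjTranspose, hT, hQ] at e2
  rw [hR, hP] at e1
  have hpair : gramForm x x W V = ∑ s, ∑ t, inner ℂ (lft R P x s t) (lft Tᴴ Qᴴ x s t) := by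
    rw [← gramForm_mul, ← hW, ← hV]
  rw [hpair]
  have hcs : ‖∑ s, ∑ t, inner ℂ (lft R P x s t) (lft Tᴴ Qᴴ x s t)‖ ≤
      √(∑ s, ∑ t, ‖lft R P x s t‖ ^ 2) * √(∑ s, ∑ t, ‖lft Tᴴ Qᴴ x s t‖ ^ 2) := by
    rw [← Fintype.sum_prod_type', ← Fintype.sum_prod_type', ← Fintype.sum_prod_type']
    refine (norm_sum_le _ _).trans ((Finset.sum_le_sum fun p _ => norm_inner_le_norm _ _).trans ?_)
    exact Real.sum_mul_le_sqrt_mul_sqrt _ _ _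
  refine hcs.trans ((mul_le_mul (Real.sqrt_le_sqrt e1) (Real.sqrt_le_sqrt e2)
    (Real.sqrt_nonneg _) (Real.sqrt_nonneg _)).trans (le_of_eq ?_))
  exact Real.mul_self_sqrt (by positivity)

end Hat

/-! ### The evaluation at `1 / 2` is completely contractive -/

/-- The outer function of the strip with constant modulus `a` and `b` on the two boundary lines. -/
def outer (a b : ℝ) (z : ℂ) : ℂ := Complex.exp ((1 - z) * Real.log a + z * Real.log b)

lemma differentiable_outer (a b : ℝ) : Differentiable ℂ (outer a b) := by
  unfold outer; fun_prop

lemma norm_outer (a b : ℝ) (z : ℂ) :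
    ‖outer a b z‖ = Real.exp ((1 - z.re) * Real.log a + z.re * Real.log b) := by
  rw [outer, Complex.norm_exp]
  simp

lemma norm_outer_line_zero {a : ℝ} (ha : 0 < a) (b t : ℝ) : ‖outer a b (line 0 t)‖ = a := by
  rw [norm_outer]
  simp [line, Real.exp_log ha]

lemma norm_outer_line_one (a : ℝ) {b : ℝ} (hb : 0 < b) (t : ℝ) : ‖outer a b (line 1 t)‖ = b := by
  rw [norm_outer]
  simp [line, Real.exp_log hb]

lemma norm_outer_half_sq {a b : ℝ} (ha : 0 < a) (hb : 0 < b) : ‖outer a b (1 / 2)‖ ^ 2 = a * b := by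
  rw [norm_outer, ← Real.exp_nat_mul]
  norm_num
  rw [show 2 * (1 / 2 * Real.log a + 1 / 2 * Real.log b) = Real.log a + Real.log b by ring,
    Real.exp_add, Real.exp_log ha, Real.exp_log hb]

lemma outer_bounded (a b : ℝ) : ∃ c, ∀ z ∈ closure strip, ‖outer a b z‖ ≤ c := by
  refine ⟨Real.exp (|Real.log a| + |Real.log b|), fun z hz => ?_⟩
  rw [closure_strip] at hz
  obtain ⟨h0, h1⟩ := hz
  rw [norm_outer, Real.exp_le_exp]
  have ha := le_abs_self (Real.log a)
  have hb := le_abs_self (Real.log b)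
  have ha0 := abs_nonneg (Real.log a)
  have hb0 := abs_nonneg (Real.log b)
  nlinarith

lemma IsBddHol.outer_smul {f : ℂ → Ell2} (hf : IsBddHol f) (a b : ℝ) :
    IsBddHol fun z => outer a b z • f z := by
  obtain ⟨M, hM⟩ := hf.2
  obtain ⟨c, hc⟩ := outer_bounded a b
  refine ⟨(differentiable_outer a b).diffContOnCl.smul hf.1, c * M, fun z hz => ?_⟩
  rw [norm_smul]
  exact mul_le_mul (hc z hz) (hM z hz) (norm_nonneg _) ((norm_nonneg _).trans (hc z hz))

/-- The mean inequality at `1 / 2` is applied to `f` times the outer function of moduli `a` and `b`;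
the outer factor contributes `ab` at the midpoint and `a²`, `b²` on the lines. -/
lemma norm_evalHalf_sq_le_of_mem {g : hardy} (hg : (g : L2left × L2right) ∈ bddHolBdry) {a b : ℝ}
    (ha : 0 < a) (hb : 0 < b) :
    a * b * ‖evalHalf g‖ ^ 2 ≤
      (a ^ 2 * ‖(g : L2left × L2right).1‖ ^ 2 + b ^ 2 * ‖(g : L2left × L2right).2‖ ^ 2) / 2 := by
  obtain ⟨f, hf, hfg⟩ := hg
  have h := (hf.outer_smul a b).norm_sq_half_le
  rw [evalHalf_eq (hf.isAnalyticExtension hfg), norm_sq_Lp hfg.1, norm_sq_Lp hfg.2]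
  simp only [norm_smul, mul_pow] at h
  rw [norm_outer_half_sq ha hb] at h
  refine h.trans (le_of_eq ?_)
  congr 2
  · rw [← integral_const_mul]
    exact integral_congr_ae (ae_lineMeasure fun t => by
      simp only [norm_outer_line_zero ha])
  · rw [← integral_const_mul]
    exact integral_congr_ae (ae_lineMeasure fun t => by
      simp only [norm_outer_line_one _ hb])

/-- Both sides are continuous in `g`, so density of the bounded functions suffices. A zero weight
has no outer function but makes the left side vanish. -/
lemma norm_evalHalf_sq_le (g : hardy) {a b : ℝ} (ha : 0 ≤ a) (hb : 0 ≤ b) :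
    a * b * ‖evalHalf g‖ ^ 2 ≤
      (a ^ 2 * ‖(g : L2left × L2right).1‖ ^ 2 + b ^ 2 * ‖(g : L2left × L2right).2‖ ^ 2) / 2 := by
  rcases ha.eq_or_lt with rfl | ha
  · simp only [zero_mul]; positivity
  rcases hb.eq_or_lt with rfl | hb
  · simp only [mul_zero, zero_mul]; positivity
  have hclosed : IsClosed {g : hardy | a * b * ‖evalHalf g‖ ^ 2 ≤
      (a ^ 2 * ‖(g : L2left × L2right).1‖ ^ 2 + b ^ 2 * ‖(g : L2left × L2right).2‖ ^ 2) / 2} := by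
    have := continuous_evalHalf
    exact isClosed_le (by fun_prop) (by fun_prop)
  obtain ⟨u, hu, hlim⟩ := mem_closure_iff_seq_limit.1
    (show (g : L2left × L2right) ∈ closure (bddHolBdry : Set (L2left × L2right)) from g.2)
  have hlim' : Tendsto (fun k => (⟨u k, bddHolBdry_le_hardy (hu k)⟩ : hardy)) atTop (𝓝 g) :=
    tendsto_subtype_rng.2 hlim
  have hmem := hclosed.mem_of_tendsto hlim' (Eventually.of_forall fun k =>
    norm_evalHalf_sq_le_of_mem (g := ⟨u k, bddHolBdry_le_hardy (hu k)⟩) (hu k) ha hb)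
  exact hmem

-- Evaluation commutes with `hat`, so the weighted scalar inequality with `a = α t`, `b = β s`
-- applies to every coefficient. Summing the first term over `s` meets the row bound, and summing
-- the second over `t` meets the column bound, at unit vectors in each case.
open Matrix in
theorem ohNorms_evalHalf_le {n : ℕ} (y : Matrix (Fin n) (Fin n) hardy) :
    ohNorms n (y.map evalHalf) ≤ bdryNorms n (y.map Subtype.val) := by
  set c := bdryNorms n (y.map Subtype.val) with hc
  have hc0 : 0 ≤ c := bdryNorms_nonneg _
  obtain ⟨hrow, hcol⟩ := (bdryNorms_le_iff _ hc0).1 hc.symm.le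
  refine Real.sqrt_le_iff.2 ⟨hc0, matNorm_gram_le_of_conjDiag (by positivity) ?_⟩
  intro U P α β hU hU' hP hP' hα hβ
  -- First with the arithmetic mean; the geometric mean follows by scaling `α` and `β`.
  have key : ∀ α β : Fin n → ℝ, (∀ i, 0 ≤ α i) → (∀ i, 0 ≤ β i) →
      ∑ s, ∑ t, α t * β s * ‖hat U P (y.map evalHalf) s t‖ ^ 2 ≤
        c ^ 2 * ((∑ i, α i ^ 2) + ∑ i, β i ^ 2) / 2 := by
    intro α β hα hβ
    have h1 : ∀ s t, α t * β s * ‖hat U P (y.map evalHalf) s t‖ ^ 2 ≤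
        (α t ^ 2 * ‖hat U P ((y.map Subtype.val).map Prod.fst) s t‖ ^ 2 +
          β s ^ 2 * ‖hat U P ((y.map Subtype.val).map Prod.snd) s t‖ ^ 2) / 2 := by
      intro s t
      have := norm_evalHalf_sq_le (hat U P y s t) (hα t) (hβ s)
      have e0 : ((hat U P y s t : hardy) : L2left × L2right).1 =
          hat U P ((y.map Subtype.val).map Prod.fst) s t :=
        map_hat ((LinearMap.fst ℂ L2left L2right).comp hardy.subtype) U P y s t
      have e1 : ((hat U P y s t : hardy) : L2left × L2right).2 =
          hat U P ((y.map Subtype.val).map Prod.snd) s t :=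
        map_hat ((LinearMap.snd ℂ L2left L2right).comp hardy.subtype) U P y s t
      rwa [map_hat, e0, e1] at this
    refine (Finset.sum_le_sum fun s _ => Finset.sum_le_sum fun t _ => h1 s t).trans ?_
    have hUn := sum_norm_sq_column hU'
    have hPn : ∀ s, ∑ j, ‖star (P j s)‖ ^ 2 = 1 := fun s => by
      simpa only [norm_star] using sum_norm_sq_column hP' s
    have h2 : ∑ s, ∑ t, α t ^ 2 * ‖hat U P ((y.map Subtype.val).map Prod.fst) s t‖ ^ 2 ≤
        c ^ 2 * ∑ i, α i ^ 2 := by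
      rw [Finset.sum_comm, Finset.mul_sum]
      refine Finset.sum_le_sum fun t _ => ?_
      rw [← Finset.mul_sum, sum_hat_row U hP, mul_comm (c ^ 2)]
      have := hrow fun i => U i t
      rw [hUn, mul_one] at this
      exact mul_le_mul_of_nonneg_left this (sq_nonneg _)
    have h3 : ∑ s, ∑ t, β s ^ 2 * ‖hat U P ((y.map Subtype.val).map Prod.snd) s t‖ ^ 2 ≤
        c ^ 2 * ∑ i, β i ^ 2 := by
      rw [Finset.mul_sum]
      refine Finset.sum_le_sum fun s _ => ?_
      rw [← Finset.mul_sum, sum_hat_col hU, mul_comm (c ^ 2)]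
      have := hcol fun j => star (P j s)
      rw [hPn, mul_one] at this
      exact mul_le_mul_of_nonneg_left this (sq_nonneg _)
    simp only [← Finset.sum_div, Finset.sum_add_distrib]
    linarith
  set p := √(∑ i, α i ^ 2) with hp
  set q := √(∑ i, β i ^ 2) with hq
  have hp2 : p ^ 2 = ∑ i, α i ^ 2 := Real.sq_sqrt (by positivity)
  have hq2 : q ^ 2 = ∑ i, β i ^ 2 := Real.sq_sqrt (by positivity)
  have hzero : ∀ γ : Fin n → ℝ, √(∑ i, γ i ^ 2) = 0 → ∀ i, γ i = 0 := fun γ h i => by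
    rw [Real.sqrt_eq_zero (by positivity), Finset.sum_eq_zero_iff_of_nonneg
      fun i _ => sq_nonneg _] at h
    exact pow_eq_zero_iff two_ne_zero |>.1 (h i (Finset.mem_univ i))
  have hp0 : 0 ≤ p := Real.sqrt_nonneg _
  have hq0 : 0 ≤ q := Real.sqrt_nonneg _
  -- If all weights of one family vanish, both sides are zero; otherwise both families are
  -- normalized to unit length, where arithmetic and geometric mean coincide.
  rcases hp0.eq_or_lt with h0 | hp0
  · simp [hzero α h0.symm, ← h0]
  rcases hq0.eq_or_lt with h0 | hq0
  · simp [hzero β h0.symm, ← h0]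
  have h := key (fun i => α i / p) (fun i => β i / q) (fun i => div_nonneg (hα i) hp0.le)
    fun i => div_nonneg (hβ i) hq0.le
  simp only [div_pow, ← Finset.sum_div] at h
  rw [← hp2, ← hq2, div_self (by positivity), div_self (by positivity)] at h
  have e : ∑ s, ∑ t, α t / p * (β s / q) * ‖hat U P (y.map evalHalf) s t‖ ^ 2 =
      (∑ s, ∑ t, α t * β s * ‖hat U P (y.map evalHalf) s t‖ ^ 2) / (p * q) := by
    simp only [Finset.sum_div]
    refine Finset.sum_congr rfl fun s _ => Finset.sum_congr rfl fun t _ => ?_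
    field_simp
  rw [e, div_le_iff₀ (by positivity)] at h
  linarith

/-! ### Positive functionals on matrices -/

section Duality

open scoped ComplexOrder
open Matrix

variable {n : ℕ}

/-- The real part of the quadratic form of a matrix. -/
def quadRe (A : Matrix (Fin n) (Fin n) ℂ) (v : Fin n → ℂ) : ℝ :=
  (∑ j, ∑ l, star (v j) * A j l * v l).re

lemma quadRe_add (A B : Matrix (Fin n) (Fin n) ℂ) (v : Fin n → ℂ) :
    quadRe (A + B) v = quadRe A v + quadRe B v := by
  simp only [quadRe, Matrix.add_apply, mul_add, add_mul, Finset.sum_add_distrib, Complex.add_re]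

lemma quadRe_smul (r : ℝ) (A : Matrix (Fin n) (Fin n) ℂ) (v : Fin n → ℂ) :
    quadRe (r • A) v = r * quadRe A v := by
  rw [quadRe, quadRe, ← Complex.re_ofReal_mul, Finset.mul_sum]
  congr 1
  refine Finset.sum_congr rfl fun j _ => ?_
  rw [Finset.mul_sum]
  refine Finset.sum_congr rfl fun l _ => ?_
  rw [Matrix.smul_apply, Complex.real_smul]
  ring

lemma quadRe_one (v : Fin n → ℂ) : quadRe 1 v = ∑ j, ‖v j‖ ^ 2 := by
  have : ∑ j, ∑ l, star (v j) * (1 : Matrix (Fin n) (Fin n) ℂ) j l * v l =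
      ((∑ j, ‖v j‖ ^ 2 : ℝ) : ℂ) := by
    push_cast
    refine Finset.sum_congr rfl fun j _ => ?_
    rw [Finset.sum_eq_single j (fun l _ hl => by rw [one_apply_ne hl.symm, mul_zero, zero_mul])
      (fun h => absurd (Finset.mem_univ j) h), one_apply_eq, mul_one, Complex.star_def,
      Complex.conj_mul']
  rw [quadRe, this, Complex.ofReal_re]

lemma quadRe_vecMulVec_nonneg (v w : Fin n → ℂ) : 0 ≤ quadRe (vecMulVec v (star v)) w := by
  have : ∑ j, ∑ l, star (w j) * vecMulVec v (star v) j l * w l =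
      ((‖∑ j, star (w j) * v j‖ ^ 2 : ℝ) : ℂ) := by
    push_cast
    rw [← Complex.mul_conj', map_sum, Finset.sum_mul_sum]
    refine Finset.sum_congr rfl fun j _ => Finset.sum_congr rfl fun l _ => ?_
    rw [vecMulVec_apply, map_mul, Pi.star_apply, ← Complex.star_def, star_star]
    ring
  rw [quadRe, this, Complex.ofReal_re]
  positivity

lemma quadRe_le (A : Matrix (Fin n) (Fin n) ℂ) (v : Fin n → ℂ) :
    quadRe A v ≤ matNorm A * ∑ j, ‖v j‖ ^ 2 := by
  set w : EuclideanSpace ℂ (Fin n) := WithLp.toLp 2 v with hw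
  have h : ∑ j, ∑ l, star (v j) * A j l * v l =
      inner ℂ w (Matrix.toEuclideanCLM (n := Fin n) (𝕜 := ℂ) A w) := by
    rw [hw, Matrix.toEuclideanCLM_toLp, PiLp.inner_apply]
    refine Finset.sum_congr rfl fun j _ => ?_
    simp only [RCLike.inner_apply, mulVec, dotProduct, Finset.sum_mul]
    refine Finset.sum_congr rfl fun l _ => ?_
    rw [starRingEnd_apply]
    ring
  have hn : ‖w‖ ^ 2 = ∑ j, ‖v j‖ ^ 2 := by rw [PiLp.norm_sq_eq_of_L2]
  rw [quadRe, h, ← hn]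
  refine (Complex.re_le_norm _).trans ((norm_inner_le_norm _ _).trans ?_)
  have := (Matrix.toEuclideanCLM (n := Fin n) (𝕜 := ℂ) A).le_opNorm w
  calc _ ≤ ‖w‖ * (matNorm A * ‖w‖) := mul_le_mul_of_nonneg_left this (norm_nonneg _)
    _ = _ := by ring

/-- A real functional is the real part of the complex-linear one `A ↦ ℓ A - i ℓ(iA)`; the
coefficients are its values on matrix units. -/
lemma functional_eq (ℓ : Matrix (Fin n) (Fin n) ℂ →ₗ[ℝ] ℝ) (A : Matrix (Fin n) (Fin n) ℂ) :
    ℓ A = (∑ j, ∑ l, A j l * (⟨ℓ (single j l 1), -ℓ (single j l Complex.I)⟩ : ℂ)).re := by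
  have h : ∀ (j l : Fin n) (z : ℂ), ℓ (single j l z) =
      (z * (⟨ℓ (single j l 1), -ℓ (single j l Complex.I)⟩ : ℂ)).re := by
    intro j l z
    have e : single j l z = z.re • single j l (1 : ℂ) + z.im • single j l Complex.I := by
      rw [smul_single, smul_single, ← single_add]
      congr 1
      simp
    rw [e, map_add, map_smul, map_smul, Complex.mul_re]
    simp
  conv_lhs => rw [matrix_eq_sum_single A]
  rw [map_sum, Complex.re_sum]
  refine Finset.sum_congr rfl fun j _ => ?_
  rw [map_sum, Complex.re_sum]
  exact Finset.sum_congr rfl fun l _ => h j l _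

/-- Real linear functionals that are nonnegative on positive matrices, in diagonal form. -/
lemma exists_diag_functional (ℓ : Matrix (Fin n) (Fin n) ℂ →ₗ[ℝ] ℝ)
    (hℓ : ∀ v : Fin n → ℂ, 0 ≤ ℓ (vecMulVec v (star v))) :
    ∃ (U : Matrix (Fin n) (Fin n) ℂ) (a : Fin n → ℝ), U * Uᴴ = 1 ∧ Uᴴ * U = 1 ∧ (∀ t, 0 ≤ a t) ∧
      ∀ A : Matrix (Fin n) (Fin n) ℂ, A.IsHermitian →
        ℓ A = ∑ t, a t * quadRe A fun i => U i t := by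
  set c : Matrix (Fin n) (Fin n) ℂ :=
    Matrix.of fun j l => (⟨ℓ (single j l 1), -ℓ (single j l Complex.I)⟩ : ℂ) with hc
  have hc' : ∀ A, ℓ A = (∑ j, ∑ l, A j l * c j l).re := functional_eq ℓ
  -- Hermitian matrices see only the Hermitian part of the conjugated coefficient matrix, and for
  -- them the real part can be dropped.
  set M : Matrix (Fin n) (Fin n) ℂ := Matrix.of fun j l => (star (c j l) + c l j) / 2 with hM
  have key : ∀ A : Matrix (Fin n) (Fin n) ℂ, A.IsHermitian →
      ((ℓ A : ℝ) : ℂ) = ∑ j, ∑ l, A j l * star (M j l) := by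
    intro A hA
    have h1 : star (∑ j, ∑ l, A j l * c j l) = ∑ j, ∑ l, A j l * star (c l j) := by
      rw [star_sum, Finset.sum_comm]
      simp only [star_sum]
      rw [Finset.sum_comm]
      refine (Finset.sum_congr rfl fun j _ => Finset.sum_congr rfl fun l _ => ?_).trans
        Finset.sum_comm
      rw [star_mul', hA.apply]
    have h2 : ∑ j, ∑ l, A j l * star (M j l) =
        ((∑ j, ∑ l, A j l * c j l) + star (∑ j, ∑ l, A j l * c j l)) / 2 := by
      rw [h1, ← Finset.sum_add_distrib, Finset.sum_div]
      refine Finset.sum_congr rfl fun j _ => ?_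
      rw [← Finset.sum_add_distrib, Finset.sum_div]
      refine Finset.sum_congr rfl fun l _ => ?_
      simp only [hM, of_apply, star_div₀, star_add, star_star, star_ofNat]
      ring
    rw [h2, hc' A, Complex.star_def, Complex.add_conj]
    push_cast
    ring
  have hMpos : M.PosSemidef := by
    refine PosSemidef.of_dotProduct_mulVec_nonneg ?_ fun v => ?_
    · ext j l
      simp only [hM, conjTranspose_apply, of_apply, star_div₀, star_add, star_star, star_ofNat]
      ring
    · have hE : (vecMulVec v (star v)).IsHermitian := by
        ext j l
        simp [vecMulVec_apply, mul_comm]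
      have h := key _ hE
      -- The quadratic form of `M` at `v` is the value of `ℓ` on the rank-one matrix `v v*`, so
      -- positivity of `ℓ` makes `M` positive semidefinite. The spectral theorem for `M` then
      -- supplies `U` and `a`.
      have e : star v ⬝ᵥ M *ᵥ v = star ((ℓ (vecMulVec v (star v)) : ℝ) : ℂ) := by
        rw [h, star_sum]
        simp only [dotProduct, mulVec, Finset.mul_sum, star_sum]
        refine Finset.sum_congr rfl fun j _ => Finset.sum_congr rfl fun l _ => ?_
        simp only [vecMulVec_apply, Pi.star_apply, star_mul', star_star]
        ring
      rw [e, Complex.star_def, Complex.conj_ofReal]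
      exact_mod_cast hℓ v
  obtain ⟨U, a, hU, hU', ha, hMU⟩ := exists_conjDiag hMpos
  refine ⟨U, a, hU, hU', ha, fun A hA => ?_⟩
  have hMe : ∀ j l, star (M j l) = ∑ t, (a t : ℂ) * (star (U j t) * U l t) := by
    intro j l
    rw [hMU, conjDiag, mul_apply, star_sum]
    refine Finset.sum_congr rfl fun t _ => ?_
    have ha' : star (a t : ℂ) = a t := Complex.conj_ofReal _
    simp only [mul_diagonal, conjTranspose_apply, star_mul', star_star, ha']
    ring
  have h := congrArg Complex.re (key A hA)
  rw [Complex.ofReal_re] at h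
  rw [h]
  simp only [quadRe, ← Complex.re_ofReal_mul, ← Complex.re_sum]
  congr 1
  simp only [hMe, Finset.mul_sum]
  rw [Finset.sum_comm (γ := Fin n) (s := Finset.univ) (t := Finset.univ)
    (f := fun t j => ∑ l, (a t : ℂ) * (star (U j t) * A j l * U l t))]
  refine Finset.sum_congr rfl fun j _ => ?_
  rw [Finset.sum_comm]
  refine Finset.sum_congr rfl fun t _ => Finset.sum_congr rfl fun l _ => ?_
  ring

end Duality

/-! ### Lifting from `OH` -/

section Lift

open scoped ComplexOrder
open Matrix

variable {n : ℕ}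

/-- The inverse of `hat` for unitary matrices. -/
def unhat {M : Type*} [AddCommGroup M] [Module ℂ M] (U P : Matrix (Fin n) (Fin n) ℂ)
    (g : Fin n → Fin n → M) : Matrix (Fin n) (Fin n) M :=
  Matrix.of fun i j => ∑ s, ∑ t, (star (U i t) * P j s) • g s t

lemma sum_delta_smul {M : Type*} [AddCommGroup M] [Module ℂ M] (g : Fin n → Fin n → M)
    {s t : Fin n} {δ ε : Fin n → ℂ} (hδ : ∀ s', δ s' = if s' = s then 1 else 0)
    (hε : ∀ t', ε t' = if t' = t then 1 else 0) :
    ∑ s', ∑ t', (δ s' * ε t') • g s' t' = g s t := by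
  simp [hδ, hε]

lemma sum_sum_smul_comm {M : Type*} [AddCommGroup M] [Module ℂ M] (g : Fin n → Fin n → M)
    (A B C D : Fin n → Fin n → ℂ) :
    ∑ i, ∑ j, ∑ s, ∑ t, (A i t * B j s * (C i t * D j s)) • g s t =
      ∑ s, ∑ t, ((∑ j, B j s * D j s) * ∑ i, A i t * C i t) • g s t := by
  simp only [Finset.sum_mul_sum, Finset.sum_smul, ← Fintype.sum_prod_type']
  let e : Fin n × Fin n × Fin n × Fin n ≃ Fin n × Fin n × Fin n × Fin n :=
    ⟨fun p => (p.2.2.1, p.2.2.2, p.2.1, p.1), fun q => (q.2.2.2, q.2.2.1, q.1, q.2.1),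
      fun _ => rfl, fun _ => rfl⟩
  refine Fintype.sum_equiv e _ _ ?_
  rintro ⟨i, j, s, t⟩
  simp only [e, Equiv.coe_fn_mk]
  congr 1
  ring

lemma sum_column_mul {U : Matrix (Fin n) (Fin n) ℂ} (hU : Uᴴ * U = 1) (t t' : Fin n) :
    ∑ i, U i t * star (U i t') = if t' = t then 1 else 0 := by
  have h := congrFun (congrFun hU t') t
  rw [mul_apply, one_apply] at h
  rw [← h]
  exact Finset.sum_congr rfl fun i _ => mul_comm _ _

lemma hat_unhat {M : Type*} [AddCommGroup M] [Module ℂ M] {U P : Matrix (Fin n) (Fin n) ℂ}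
    (hU : Uᴴ * U = 1) (hP : Pᴴ * P = 1) (g : Fin n → Fin n → M) (s t : Fin n) :
    hat U P (unhat U P g) s t = g s t := by
  simp only [hat, unhat, of_apply, Finset.smul_sum, smul_smul]
  rw [sum_sum_smul_comm g (fun i _ => U i t) (fun j _ => star (P j s)) (fun i t => star (U i t)) P]
  refine sum_delta_smul g (fun s' => ?_) fun t' => sum_column_mul hU t t'
  rw [← (sum_column_mul hP s' s).trans (if_congr eq_comm rfl rfl)]
  exact Finset.sum_congr rfl fun j _ => mul_comm _ _

lemma sum_row_mul {U : Matrix (Fin n) (Fin n) ℂ} (hU : U * Uᴴ = 1) (i i' : Fin n) :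
    ∑ t, U i t * star (U i' t) = if i' = i then 1 else 0 := by
  have h := congrFun (congrFun hU i) i'
  rw [mul_apply, one_apply] at h
  rw [if_congr eq_comm rfl rfl, ← h]
  rfl

lemma unhat_hat {M : Type*} [AddCommGroup M] [Module ℂ M] {U P : Matrix (Fin n) (Fin n) ℂ}
    (hU : U * Uᴴ = 1) (hP : P * Pᴴ = 1) (x : Matrix (Fin n) (Fin n) M) :
    unhat U P (hat U P x) = x := by
  ext i j
  simp only [hat, unhat, of_apply, Finset.smul_sum, smul_smul]
  have h := sum_sum_smul_comm (fun i' j' => x i' j') (fun s _ => P j s) (fun t _ => star (U i t))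
    (fun s j' => star (P j' s)) fun t i' => U i' t
  refine (Finset.sum_congr rfl fun s _ => Finset.sum_congr rfl fun t _ => Finset.sum_congr rfl
    fun i' _ => Finset.sum_congr rfl fun j' _ => ?_).trans (h.trans
      (sum_delta_smul (fun i' j' => x i' j') (fun i' => ?_) fun j' => sum_row_mul hP j j'))
  · congr 1
    ring
  · rw [← (sum_row_mul hU i' i).trans (if_congr eq_comm rfl rfl)]
    exact Finset.sum_congr rfl fun t _ => mul_comm _ _

lemma map_unhat {M M' : Type*} [AddCommGroup M] [Module ℂ M] [AddCommGroup M'] [Module ℂ M']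
    (f : M →ₗ[ℂ] M') (U P : Matrix (Fin n) (Fin n) ℂ) (g : Fin n → Fin n → M) :
    (unhat U P g).map f = unhat U P fun s t => f (g s t) := by
  ext i j
  simp [unhat, map_sum]

/-- The elements of the Hardy space with values `v` at `1 / 2` and of constant modulus on each
boundary line. -/
lemma exists_hardy_const {p : ℝ} (hp : 0 < p) (v : Ell2) : ∃ g : hardy, evalHalf g = v ∧
    ‖(g : L2left × L2right).1‖ ^ 2 = p ^ 2 * ‖v‖ ^ 2 ∧
      ‖(g : L2left × L2right).2‖ ^ 2 = p⁻¹ ^ 2 * ‖v‖ ^ 2 := by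
  have hv : IsBddHol fun _ => v := ⟨diffContOnCl_const, ‖v‖, fun _ _ => le_rfl⟩
  have hf := hv.outer_smul p p⁻¹
  obtain ⟨b, hb⟩ := hf.exists_bdry
  have hp' : 0 < p⁻¹ := inv_pos.2 hp
  refine ⟨⟨b, bddHolBdry_le_hardy ⟨_, hf, hb⟩⟩, ?_, ?_, ?_⟩
  -- The reciprocal moduli have opposite logarithms, so the outer function equals exactly `1` at the
  -- midpoint.
  · rw [evalHalf_eq (hf.isAnalyticExtension hb), outer, Real.log_inv]
    push_cast
    rw [show (1 - 1 / 2 : ℂ) * Real.log p + 1 / 2 * -Real.log p = 0 by ring, Complex.exp_zero,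
      one_smul]
  · simp only
    rw [norm_sq_Lp hb.1, integral_congr_ae (g := fun _ => p ^ 2 * ‖v‖ ^ 2)
      (ae_lineMeasure fun t => by simp only [norm_smul, mul_pow, norm_outer_line_zero hp])]
    simp
  · simp only
    rw [norm_sq_Lp hb.2, integral_congr_ae (g := fun _ => p⁻¹ ^ 2 * ‖v‖ ^ 2)
      (ae_lineMeasure fun t => by simp only [norm_smul, mul_pow, norm_outer_line_one _ hp'])]
    simp

/-- The first component of a matrix over the Hardy space. -/
def rowPart (y : Matrix (Fin n) (Fin n) hardy) : Matrix (Fin n) (Fin n) L2left :=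
  (y.map Subtype.val).map Prod.fst

/-- The second component of a matrix over the Hardy space. -/
def colPart (y : Matrix (Fin n) (Fin n) hardy) : Matrix (Fin n) (Fin n) L2right :=
  (y.map Subtype.val).map Prod.snd

lemma fst_hat (U P : Matrix (Fin n) (Fin n) ℂ) (y : Matrix (Fin n) (Fin n) hardy) (s t : Fin n) :
    ((hat U P y s t : hardy) : L2left × L2right).1 = hat U P (rowPart y) s t :=
  map_hat ((LinearMap.fst ℂ L2left L2right).comp hardy.subtype) U P y s t

lemma snd_hat (U P : Matrix (Fin n) (Fin n) ℂ) (y : Matrix (Fin n) (Fin n) hardy) (s t : Fin n) :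
    ((hat U P y s t : hardy) : L2left × L2right).2 = hat U P (colPart y) s t :=
  map_hat ((LinearMap.snd ℂ L2left L2right).comp hardy.subtype) U P y s t

/-- For every pair of diagonal weights there is a good lift. -/
lemma exists_lift_diag (x : Matrix (Fin n) (Fin n) Ell2) {U V : Matrix (Fin n) (Fin n) ℂ}
    (hU : U * Uᴴ = 1) (hU' : Uᴴ * U = 1) (hV : V * Vᴴ = 1)
    {a b : Fin n → ℝ} (ha : ∀ t, 0 < a t) (hb : ∀ s, 0 < b s) :
    ∃ y : Matrix (Fin n) (Fin n) hardy, y.map evalHalf = x ∧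
      (∑ t, a t * colQ (rowPart y)ᵀ fun i => U i t) +
          (∑ s, b s * colQ (colPart y) fun j => V j s) ≤
        matNorm (gram x x) * ((∑ t, a t) + ∑ s, b s) := by
  -- `hat` conjugates its second unitary, while the column form is to be tested at the columns of
  -- `V` themselves.
  set P := V.map star with hPdef
  have hP : P * Pᴴ = 1 := map_star_mul_conjTranspose hV
  have hP' : Pᴴ * P = 1 := mul_eq_one_comm.1 hP
  -- With `p² = √(b s) / √(a t)` the two contributions balance: `a t * p² = b s * p⁻² = √(a t) * √(b
  -- s)`. The division needs strictly positive weights.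
  have hp : ∀ s t, 0 < √(√(b s) / √(a t)) := fun s t =>
    Real.sqrt_pos.2 (div_pos (Real.sqrt_pos.2 (hb s)) (Real.sqrt_pos.2 (ha t)))
  choose g hg h0 h1 using fun s t => exists_hardy_const (hp s t) (hat U P x s t)
  refine ⟨unhat U P g, ?_, ?_⟩
  · rw [map_unhat]
    simp only [hg]
    exact unhat_hat hU hP x
  · have e0 : ∑ t, a t * colQ (rowPart (unhat U P g))ᵀ (fun i => U i t) =
        ∑ s, ∑ t, √(a t) * √(b s) * ‖hat U P x s t‖ ^ 2 := by
      rw [Finset.sum_comm]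
      refine Finset.sum_congr rfl fun t _ => ?_
      rw [← sum_hat_row U hP, Finset.mul_sum]
      refine Finset.sum_congr rfl fun s _ => ?_
      rw [← fst_hat, hat_unhat hU' hP', h0, Real.sq_sqrt (by positivity)]
      have := Real.sqrt_pos.2 (ha t)
      nth_rewrite 1 [← Real.mul_self_sqrt (ha t).le]
      field_simp
    have e1 : ∑ s, b s * colQ (colPart (unhat U P g)) (fun j => V j s) =
        ∑ s, ∑ t, √(a t) * √(b s) * ‖hat U P x s t‖ ^ 2 := by
      refine Finset.sum_congr rfl fun s _ => ?_
      have hVP : (fun j => V j s) = fun j => star (P j s) := by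
        funext j; simp [hPdef]
      rw [hVP, ← sum_hat_col hU, Finset.mul_sum]
      refine Finset.sum_congr rfl fun t _ => ?_
      rw [← snd_hat, hat_unhat hU' hP', h1, inv_pow, Real.sq_sqrt (by positivity)]
      have := Real.sqrt_pos.2 (hb s)
      nth_rewrite 1 [← Real.mul_self_sqrt (hb s).le]
      field_simp
    -- The weights `√(a t)` and `√(b s)` have square sums `∑ a` and `∑ b`. The factor `2` from the
    -- two equal contributions is absorbed by the arithmetic–geometric mean inequality.
    have h := sum_hat_le x hU' hP' (fun t => √(a t)) fun s => √(b s)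
    simp only [Real.sq_sqrt (ha _).le, Real.sq_sqrt (hb _).le] at h
    have hA : 0 ≤ ∑ t, a t := Finset.sum_nonneg fun t _ => (ha t).le
    have hB : 0 ≤ ∑ s, b s := Finset.sum_nonneg fun s _ => (hb s).le
    have hm := matNorm_nonneg (gram x x)
    have h2 : 2 * (√(∑ t, a t) * √(∑ s, b s)) ≤ (∑ t, a t) + ∑ s, b s := by
      nlinarith [sq_nonneg (√(∑ t, a t) - √(∑ s, b s)), Real.mul_self_sqrt hA,
        Real.mul_self_sqrt hB]
    rw [e0, e1]
    nlinarith [mul_le_mul_of_nonneg_left h2 hm]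

end Lift

/-! ### One lift for all weights, by convexity and separation -/

section Minimax

open scoped ComplexOrder
open Matrix

variable {n : ℕ} {H : Type*} [NormedAddCommGroup H] [InnerProductSpace ℂ H]

/-- The Gram matrix of a column. -/
def colGram (z : Matrix (Fin n) (Fin n) H) : Matrix (Fin n) (Fin n) ℂ :=
  Matrix.of fun j l => ∑ i, inner ℂ (z i j) (z i l)

lemma isHermitian_colGram (z : Matrix (Fin n) (Fin n) H) : (colGram z).IsHermitian := by
  ext j l
  simp [colGram]

lemma quadRe_colGram (z : Matrix (Fin n) (Fin n) H) (v : Fin n → ℂ) :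
    quadRe (colGram z) v = colQ z v := by
  have : ∑ j, ∑ l, star (v j) * colGram z j l * v l = ((colQ z v : ℝ) : ℂ) := by
    rw [colQ]
    push_cast
    simp only [← inner_self_ofReal]
    have h : ∀ i, inner ℂ (∑ j, v j • z i j) (∑ j, v j • z i j) =
        ∑ j, ∑ l, star (v j) * inner ℂ (z i j) (z i l) * v l := fun i => by
      rw [sum_inner]
      refine Finset.sum_congr rfl fun j _ => ?_
      rw [inner_sum]
      refine Finset.sum_congr rfl fun l _ => ?_
      rw [inner_smul_left, inner_smul_right, starRingEnd_apply]
      ring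
    simp only [h, colGram, of_apply, Finset.mul_sum, Finset.sum_mul]
    rw [Finset.sum_comm (γ := Fin n) (f := fun i j => ∑ l,
      star (v j) * inner ℂ (z i j) (z i l) * v l)]
    exact Finset.sum_congr rfl fun j _ => Finset.sum_comm
  rw [quadRe, this, Complex.ofReal_re]

lemma colQ_convex (z z' : Matrix (Fin n) (Fin n) H) (v : Fin n → ℂ) {s t : ℝ} (hs : 0 ≤ s)
    (ht : 0 ≤ t) (hst : s + t = 1) :
    colQ ((s : ℂ) • z + (t : ℂ) • z') v ≤ s * colQ z v + t * colQ z' v := by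
  simp only [colQ, Finset.mul_sum, ← Finset.sum_add_distrib]
  refine Finset.sum_le_sum fun i _ => ?_
  have e : ∑ j, v j • ((s : ℂ) • z + (t : ℂ) • z') i j =
      (s : ℂ) • (∑ j, v j • z i j) + (t : ℂ) • ∑ j, v j • z' i j := by
    simp only [Finset.smul_sum, ← Finset.sum_add_distrib, Matrix.add_apply, Matrix.smul_apply,
      smul_add]
    exact Finset.sum_congr rfl fun j _ => by rw [smul_comm (v j), smul_comm (v j)]
  rw [e]
  have h1 := norm_add_le ((s : ℂ) • (∑ j, v j • z i j)) ((t : ℂ) • ∑ j, v j • z' i j)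
  rw [norm_smul, norm_smul, Complex.norm_real, Complex.norm_real, Real.norm_of_nonneg hs,
    Real.norm_of_nonneg ht] at h1
  refine (pow_le_pow_left₀ (norm_nonneg _) h1 2).trans ?_
  have := (convexOn_pow 2).2 (Set.mem_Ici.2 (norm_nonneg (∑ j, v j • z i j)))
    (Set.mem_Ici.2 (norm_nonneg (∑ j, v j • z' i j))) hs ht hst
  simpa using this

/-- The pairs of matrices that dominate the Gram matrices of a lift of `x`. -/
def liftSet (x : Matrix (Fin n) (Fin n) Ell2) :
    Set (Matrix (Fin n) (Fin n) ℂ × Matrix (Fin n) (Fin n) ℂ) :=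
  {A | ∃ y : Matrix (Fin n) (Fin n) hardy, y.map evalHalf = x ∧
    (∀ v, colQ (rowPart y)ᵀ v ≤ quadRe A.1 v) ∧ ∀ v, colQ (colPart y) v ≤ quadRe A.2 v}

/-- Lifts of `x` form an affine space and the forms `colQ` are convex in the lift. Using domination
instead of equality with the Gram matrices is what makes the set convex; it also makes the set
closed under adding positive matrices. -/
lemma convex_liftSet (x : Matrix (Fin n) (Fin n) Ell2) : Convex ℝ (liftSet x) := by
  rintro A ⟨y, hy, h1, h2⟩ A' ⟨y', hy', h1', h2'⟩ s t hs ht hst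
  refine ⟨(s : ℂ) • y + (t : ℂ) • y', ?_, fun v => ?_, fun v => ?_⟩
  · ext i j : 2
    have e1 : evalHalf (y i j) = x i j := congrFun (congrFun hy i) j
    have e2 : evalHalf (y' i j) = x i j := congrFun (congrFun hy' i) j
    simp only [map_apply, Matrix.add_apply, Matrix.smul_apply, map_add, map_smul, e1, e2,
      ← add_smul, ← Complex.ofReal_add, hst, Complex.ofReal_one, one_smul]
  · refine (colQ_convex (rowPart y)ᵀ (rowPart y')ᵀ v hs ht hst).trans ?_
    rw [Prod.fst_add, Prod.smul_fst, Prod.smul_fst, quadRe_add, quadRe_smul, quadRe_smul]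
    exact add_le_add (mul_le_mul_of_nonneg_left (h1 v) hs) (mul_le_mul_of_nonneg_left (h1' v) ht)
  · refine (colQ_convex (colPart y) (colPart y') v hs ht hst).trans ?_
    rw [Prod.snd_add, Prod.smul_snd, Prod.smul_snd, quadRe_add, quadRe_smul, quadRe_smul]
    exact add_le_add (mul_le_mul_of_nonneg_left (h2 v) hs) (mul_le_mul_of_nonneg_left (h2' v) ht)

/-- The pairs of matrices of norm less than `r`. -/
def normBall (n : ℕ) (r : ℝ) : Set (Matrix (Fin n) (Fin n) ℂ × Matrix (Fin n) (Fin n) ℂ) :=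
  {A | matNorm A.1 < r ∧ matNorm A.2 < r}

lemma continuous_matNorm : Continuous (matNorm : Matrix (Fin n) (Fin n) ℂ → ℝ) :=
  (LinearMap.continuous_of_finiteDimensional
    (Matrix.toEuclideanCLM (n := Fin n) (𝕜 := ℂ)).toAlgEquiv.toLinearMap).norm

lemma isOpen_normBall (r : ℝ) : IsOpen (normBall n r) :=
  (isOpen_lt (continuous_matNorm.comp continuous_fst) continuous_const).inter
    (isOpen_lt (continuous_matNorm.comp continuous_snd) continuous_const)

lemma matNorm_convex (A B : Matrix (Fin n) (Fin n) ℂ) {s t : ℝ} (hs : 0 ≤ s) (ht : 0 ≤ t) :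
    matNorm (s • A + t • B) ≤ s * matNorm A + t * matNorm B := by
  have e : ∀ (r : ℝ) (C : Matrix (Fin n) (Fin n) ℂ), r • C = (r : ℂ) • C := fun r C => by
    ext i j; simp
  have h : matNorm (s • A + t • B) ≤ matNorm (s • A) + matNorm (t • B) := by
    unfold matNorm
    rw [map_add]
    exact norm_add_le _ _
  rwa [e, e, matNorm_smul, matNorm_smul, Complex.norm_real, Complex.norm_real,
    Real.norm_of_nonneg hs, Real.norm_of_nonneg ht] at h

lemma convex_normBall (r : ℝ) : Convex ℝ (normBall n r) := by
  have key : ∀ {A B : Matrix (Fin n) (Fin n) ℂ} {s t : ℝ}, 0 ≤ s → 0 ≤ t → s + t = 1 →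
      matNorm A < r → matNorm B < r → matNorm (s • A + t • B) < r := by
    intro A B s t hs ht hst hA hB
    refine (matNorm_convex A B hs ht).trans_lt ?_
    have := (convex_Iio r) hA hB hs ht hst
    simpa using this
  rintro A ⟨h1, h2⟩ B ⟨h1', h2'⟩ s t hs ht hst
  exact ⟨key hs ht hst h1 h1', key hs ht hst h2 h2'⟩

lemma matNorm_smul_one_le {r : ℝ} (hr : 0 ≤ r) :
    matNorm (r • (1 : Matrix (Fin n) (Fin n) ℂ)) ≤ r := by
  have h1 : matNorm (1 : Matrix (Fin n) (Fin n) ℂ) ≤ 1 := by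
    unfold matNorm
    rw [map_one]
    exact ContinuousLinearMap.norm_id_le
  have := matNorm_convex (1 : Matrix (Fin n) (Fin n) ℂ) 0 hr le_rfl
  rw [zero_smul, add_zero, zero_mul, add_zero] at this
  exact this.trans (mul_le_of_le_one_right hr h1)

/-- A common point of the two convex sets is a lift of norm at most `c`. If there were none, a
separating functional would be a pair of positive functionals, that is, a choice of diagonal
weights, and the lift adapted to these weights would contradict the separation. -/
theorem exists_lift (x : Matrix (Fin n) (Fin n) Ell2) {c : ℝ} (hc : 0 < c)
    (hx : matNorm (gram x x) < c ^ 2) : ∃ y : Matrix (Fin n) (Fin n) hardy, y.map evalHalf = x ∧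
      bdryNorms n (y.map Subtype.val) ≤ c := by
  by_cases hdis : Disjoint (normBall n (c ^ 2)) (liftSet x)
  · exfalso
    obtain ⟨f, u, hf1, hf2⟩ := geometric_hahn_banach_open (convex_normBall (n := n) (c ^ 2))
      (isOpen_normBall _) (convex_liftSet x) hdis
    set ℓ₁ : Matrix (Fin n) (Fin n) ℂ →ₗ[ℝ] ℝ := f.toLinearMap ∘ₗ LinearMap.inl ℝ _ _ with hℓ₁
    set ℓ₂ : Matrix (Fin n) (Fin n) ℂ →ₗ[ℝ] ℝ := f.toLinearMap ∘ₗ LinearMap.inr ℝ _ _ with hℓ₂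
    have hf : ∀ A B, f (A, B) = ℓ₁ A + ℓ₂ B := fun A B => by
      simp only [hℓ₁, hℓ₂, LinearMap.comp_apply, LinearMap.inl_apply, LinearMap.inr_apply,
        ContinuousLinearMap.coe_coe, ← map_add, Prod.mk_add_mk, add_zero, zero_add]
    have hlift : ∀ y : Matrix (Fin n) (Fin n) hardy, y.map evalHalf = x →
        ∀ B₁ B₂ : Matrix (Fin n) (Fin n) ℂ, (∀ v, 0 ≤ quadRe B₁ v) → (∀ v, 0 ≤ quadRe B₂ v) →
        u ≤ ℓ₁ (colGram (rowPart y)ᵀ + B₁) + ℓ₂ (colGram (colPart y) + B₂) := by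
      intro y hy B₁ B₂ h1 h2
      rw [← hf]
      refine hf2 _ ⟨y, hy, fun v => ?_, fun v => ?_⟩
      · rw [quadRe_add, quadRe_colGram]
        exact le_add_of_nonneg_right (h1 v)
      · rw [quadRe_add, quadRe_colGram]
        exact le_add_of_nonneg_right (h2 v)
    obtain ⟨y₀, hy₀⟩ : ∃ y : Matrix (Fin n) (Fin n) hardy, y.map evalHalf = x := by
      choose g hg using surjective_evalHalf
      exact ⟨x.map g, by ext i j : 2; simp [hg]⟩
    have hq0 : ∀ v : Fin n → ℂ, quadRe 0 v = 0 := fun v => by simp [quadRe]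
    -- An affine function bounded below on a half-line has nonnegative slope; this is used along the
    -- rays obtained by adding rank-one positive matrices to the Gram matrices of the fixed lift
    -- `y₀`.
    have hnonneg : ∀ p q : ℝ, (∀ t : ℝ, 0 ≤ t → u ≤ p + t * q) → 0 ≤ q := by
      intro p q h
      by_contra! hq
      have h0 := h 0 le_rfl
      have := h ((p - u + 1) / -q) (div_nonneg (by linarith) (by linarith))
      rw [div_mul_eq_mul_div, div_neg, mul_div_assoc, div_self hq.ne] at this
      linarith
    have hpos₁ : ∀ v : Fin n → ℂ, 0 ≤ ℓ₁ (vecMulVec v (star v)) := by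
      intro v
      refine hnonneg (ℓ₁ (colGram (rowPart y₀)ᵀ) + ℓ₂ (colGram (colPart y₀))) _ fun t ht => ?_
      have := hlift y₀ hy₀ (t • vecMulVec v (star v)) 0 (fun w => by
        rw [quadRe_smul]; exact mul_nonneg ht (quadRe_vecMulVec_nonneg v w)) fun w => (hq0 w).ge
      rw [map_add, map_smul, add_zero, smul_eq_mul] at this
      linarith
    have hpos₂ : ∀ v : Fin n → ℂ, 0 ≤ ℓ₂ (vecMulVec v (star v)) := by
      intro v
      refine hnonneg (ℓ₁ (colGram (rowPart y₀)ᵀ) + ℓ₂ (colGram (colPart y₀))) _ fun t ht => ?_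
      have := hlift y₀ hy₀ 0 (t • vecMulVec v (star v)) (fun w => (hq0 w).ge) (fun w => by
        rw [quadRe_smul]; exact mul_nonneg ht (quadRe_vecMulVec_nonneg v w))
      rw [add_zero, map_add, map_smul, smul_eq_mul] at this
      linarith
    obtain ⟨U, a, hU, hU', ha, hUa⟩ := exists_diag_functional ℓ₁ hpos₁
    obtain ⟨V, b, hV, hV', hb, hVb⟩ := exists_diag_functional ℓ₂ hpos₂
    set T := (∑ t, a t) + ∑ s, b s with hT
    have hT0 : 0 ≤ T := add_nonneg (Finset.sum_nonneg fun t _ => ha t)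
      (Finset.sum_nonneg fun t _ => hb t)
    have h1 : ℓ₁ 1 + ℓ₂ 1 = T := by
      rw [hUa _ isHermitian_one, hVb _ isHermitian_one]
      simp only [quadRe_one, sum_norm_sq_column hU', sum_norm_sq_column hV', mul_one, hT]
    -- Multiples of the identity show that the functional reaches `r` times the total weight `T` on
    -- the ball, for every admissible `r`.
    have hball : ∀ r, 0 ≤ r → r < c ^ 2 → r * T < u := by
      intro r hr hrc
      have := hf1 (r • 1, r • 1) ⟨(matNorm_smul_one_le hr).trans_lt hrc,
        (matNorm_smul_one_le hr).trans_lt hrc⟩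
      rw [hf, map_smul, map_smul, smul_eq_mul, smul_eq_mul, ← mul_add, h1] at this
      exact this
    set m := matNorm (gram x x) with hm
    have hm0 : 0 ≤ m := matNorm_nonneg _
    -- Weights may vanish, so each of the `2n` weights is raised by `ε` before the adapted lift is
    -- taken; this adds `2nε` to the total weight.
    have hup : ∀ ε : ℝ, 0 < ε → u ≤ m * (T + ε * (2 * n)) := by
      intro ε hε
      obtain ⟨y, hy, hle⟩ := exists_lift_diag x hU hU' hV (a := fun t => a t + ε)
        (b := fun s => b s + ε) (fun t => add_pos_of_nonneg_of_pos (ha t) hε)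
        (fun s => add_pos_of_nonneg_of_pos (hb s) hε)
      have h2 := hlift y hy 0 0 (fun w => (hq0 w).ge) fun w => (hq0 w).ge
      rw [add_zero, add_zero, hUa _ (isHermitian_colGram _), hVb _ (isHermitian_colGram _)] at h2
      simp only [quadRe_colGram] at h2
      have h3 : ∑ t, a t * colQ (rowPart y)ᵀ (fun i => U i t) ≤
          ∑ t, (a t + ε) * colQ (rowPart y)ᵀ (fun i => U i t) :=
        Finset.sum_le_sum fun t _ => mul_le_mul_of_nonneg_right (by linarith) (colQ_nonneg _ _)
      have h4 : ∑ t, b t * colQ (colPart y) (fun i => V i t) ≤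
          ∑ t, (b t + ε) * colQ (colPart y) (fun i => V i t) :=
        Finset.sum_le_sum fun t _ => mul_le_mul_of_nonneg_right (by linarith) (colQ_nonneg _ _)
      refine (h2.trans (add_le_add h3 h4)).trans (hle.trans (le_of_eq ?_))
      simp only [Finset.sum_add_distrib, Finset.sum_const, Finset.card_univ, Fintype.card_fin,
        nsmul_eq_mul, hT]
      ring
    have hlim : u ≤ m * T := by
      have : Tendsto (fun ε : ℝ => m * (T + ε * (2 * n))) (𝓝[>] 0) (𝓝 (m * (T + 0 * (2 * n)))) :=
        ((tendsto_id.mono_left nhdsWithin_le_nhds).mul_const _ |>.const_add _).const_mul _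
      rw [zero_mul, add_zero] at this
      exact ge_of_tendsto this (eventually_mem_nhdsWithin.mono fun ε hε => hup ε hε)
    -- The choice `r = m`, allowed because `m < c²`, gives `m T < u`, against the limit `u ≤ m T`.
    exact absurd (hball m hm0 hx) (not_lt.2 hlim)
  · obtain ⟨A, ⟨hA1, hA2⟩, y, hy, h1, h2⟩ := Set.not_disjoint_iff.1 hdis
    refine ⟨y, hy, (bdryNorms_le_iff _ hc.le).2 ⟨fun v => ?_, fun v => ?_⟩⟩
    · exact (h1 v).trans ((quadRe_le _ _).trans
        (mul_le_mul_of_nonneg_right hA1.le (by positivity)))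
    · exact (h2 v).trans ((quadRe_le _ _).trans
        (mul_le_mul_of_nonneg_right hA2.le (by positivity)))

end Minimax

/-! ### Complete isometries -/

/-- Lifts of a matrix over the quotient are the matrices with prescribed evaluation. Contractivity
of the evaluation bounds the infimum below, and lifts of norm at most `m + ε` bound it above. -/
theorem isCompletelyIsometric_quotEquiv :
    IsCompletelyIsometric (quotientNorms (subNorms bdryNorms hardy) hardyVanishing) ohNorms
      quotEquiv := by
  intro n X
  have hmap : ∀ y : Matrix (Fin n) (Fin n) hardy, y.map hardyVanishing.mkQ = X →
      y.map evalHalf = X.map quotEquiv := by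
    rintro y rfl
    refine Matrix.ext fun i j => ?_
    exact (quotEquiv_mkQ (y i j)).symm
  have hmap' : ∀ y : Matrix (Fin n) (Fin n) hardy, y.map evalHalf = X.map quotEquiv →
      y.map hardyVanishing.mkQ = X := by
    intro y hy
    ext i j : 2
    refine quotEquiv.injective ?_
    exact (quotEquiv_mkQ (y i j)).trans (congrFun (congrFun hy i) j)
  set m := ohNorms n (X.map quotEquiv) with hm
  have hm0 : 0 ≤ m := Real.sqrt_nonneg _
  have hlift : ∀ ε : ℝ, 0 < ε → ∃ y : Matrix (Fin n) (Fin n) hardy,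
      y.map hardyVanishing.mkQ = X ∧ bdryNorms n (y.map Subtype.val) ≤ m + ε := by
    intro ε hε
    obtain ⟨y, hy, hle⟩ := exists_lift (X.map quotEquiv) (c := m + ε) (by linarith) (by
      rw [← ohNorms_sq, ← hm]
      nlinarith)
    exact ⟨y, hmap' y hy, hle⟩
  have hbdd : BddBelow {r : ℝ | ∃ y : Matrix (Fin n) (Fin n) hardy,
      y.map hardyVanishing.mkQ = X ∧ subNorms bdryNorms hardy n y = r} := by
    refine ⟨0, ?_⟩
    rintro r ⟨y, -, rfl⟩
    exact bdryNorms_nonneg _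
  rw [quotientNorms]
  refine le_antisymm (le_csInf ?_ ?_) (le_of_forall_pos_le_add fun ε hε => ?_)
  · obtain ⟨y, hy, -⟩ := hlift 1 one_pos
    exact ⟨_, y, hy, rfl⟩
  · rintro r ⟨y, hy, rfl⟩
    rw [hm, ← hmap y hy]
    exact ohNorms_evalHalf_le y
  · obtain ⟨y, hy, hle⟩ := hlift ε hε
    exact (csInf_le hbdd ⟨y, hy, rfl⟩).trans hle

/-- A complete isometry of operator spaces restricts to subspaces and passes to quotients. -/
lemma IsCompletelyIsometric.quotient {E F G : Type*} [AddCommGroup E] [Module ℂ E]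
    [AddCommGroup F] [Module ℂ F] [AddCommGroup G] [Module ℂ G] {ν : MatrixNorms E}
    {ρ : MatrixNorms F} {τ : MatrixNorms G} {U : E ≃ₗ[ℂ] F} (hU : IsCompletelyIsometric ν ρ U)
    {S : Submodule ℂ E} {S' : Submodule ℂ F} (e : S ≃ₗ[ℂ] S') (he : ∀ s, (e s : F) = U s)
    {N : Submodule ℂ S} {N' : Submodule ℂ S'} (hN : N.map (e : S →ₗ[ℂ] S') = N')
    {φ : (S ⧸ N) ≃ₗ[ℂ] G} (hφ : IsCompletelyIsometric (quotientNorms (subNorms ν S) N) τ φ) :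
    IsCompletelyIsometric (quotientNorms (subNorms ρ S') N') τ
      ((Submodule.Quotient.equiv N N' e hN).symm.trans φ) := by
  intro n X
  set q := Submodule.Quotient.equiv N N' e hN with hq
  have h := hφ n (X.map q.symm)
  rw [Matrix.map_map] at h
  refine h.trans ?_
  rw [quotientNorms, quotientNorms]
  congr 1
  ext r
  have hnorm : ∀ y : Matrix (Fin n) (Fin n) S, subNorms ρ S' n (y.map e) = subNorms ν S n y := by
    intro y
    have := hU n (y.map Subtype.val)
    rw [subNorms, subNorms, ← this, Matrix.map_map, Matrix.map_map]
    congr 1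
    ext i j
    exact he (y i j)
  have hqe : ∀ s : S, q (N.mkQ s) = N'.mkQ (e s) := fun s => rfl
  constructor
  · rintro ⟨y, hy, rfl⟩
    refine ⟨y.map e, ?_, hnorm y⟩
    ext i j : 2
    have := congrFun (congrFun hy i) j
    simp only [Matrix.map_apply] at this ⊢
    rw [← hqe, this, q.apply_symm_apply]
  · rintro ⟨y, hy, rfl⟩
    refine ⟨y.map e.symm, ?_, ?_⟩
    · ext i j : 2
      have := congrFun (congrFun hy i) j
      simp only [Matrix.map_apply] at this ⊢
      rw [← this, LinearEquiv.eq_symm_apply, hqe, e.apply_symm_apply]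
    · rw [← hnorm, Matrix.map_map]
      congr 1
      ext i j : 2
      simp

lemma isClosed_hardy : IsClosed (hardy : Set (L2left × L2right)) :=
  Submodule.isClosed_topologicalClosure _

lemma isClosed_hardyVanishing : IsClosed (hardyVanishing : Set hardy) := by
  rw [← ker_evalHalf]
  exact isClosed_singleton.preimage continuous_evalHalf

/-- Transport of a quotient of a subspace along a bicontinuous complete isometry. -/
lemma IsCompletelyIsometric.exists_quotient {E F G : Type*} [AddCommGroup E] [Module ℂ E]
    [TopologicalSpace E] [AddCommGroup F] [Module ℂ F] [TopologicalSpace F] [AddCommGroup G]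
    [Module ℂ G] {ν : MatrixNorms E} {ρ : MatrixNorms F} {τ : MatrixNorms G} (U : E ≃L[ℂ] F)
    (hU : IsCompletelyIsometric ν ρ U.toLinearEquiv) {S : Submodule ℂ E} {N : Submodule ℂ S}
    (hS : IsClosed (S : Set E)) (hN : IsClosed (N : Set S)) {φ : (S ⧸ N) ≃ₗ[ℂ] G}
    (hφ : IsCompletelyIsometric (quotientNorms (subNorms ν S) N) τ φ) :
    ∃ (S' : Submodule ℂ F) (N' : Submodule ℂ S') (ψ : (S' ⧸ N') ≃ₗ[ℂ] G),
      IsClosed (S' : Set F) ∧ IsClosed (N' : Set S') ∧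
      IsCompletelyIsometric (quotientNorms (subNorms ρ S') N') τ ψ := by
  obtain ⟨S', e, he, hS', hc⟩ : ∃ (S' : Submodule ℂ F) (e : S ≃ₗ[ℂ] S'),
      (∀ s, (e s : F) = U.toLinearEquiv s) ∧ IsClosed (S' : Set F) ∧ Continuous e.symm :=
    ⟨S.map U.toLinearEquiv.toLinearMap, U.toLinearEquiv.submoduleMap S, fun s => rfl,
      U.toHomeomorph.isClosedMap _ hS,
      continuous_induced_rng.2 (U.symm.continuous.comp continuous_subtype_val)⟩
  refine ⟨S', N.map (e : S →ₗ[ℂ] S'), _, hS', ?_, hU.quotient e he rfl hφ⟩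
  have : (N.map (e : S →ₗ[ℂ] S') : Set S') = e.symm ⁻¹' N := by
    rw [Submodule.map_coe]
    exact e.toEquiv.image_eq_preimage_symm _
  rw [this]
  exact hN.preimage hc

theorem exists_quotient_of_subspace :
    ∃ (S : Submodule ℂ (Ell2 × Ell2)) (N : Submodule ℂ S) (φ : (S ⧸ N) ≃ₗ[ℂ] Ell2),
      IsClosed (S : Set (Ell2 × Ell2)) ∧ IsClosed (N : Set S) ∧
      IsCompletelyIsometric (quotientNorms (subNorms rowPlusCol S) N) ohNorms φ := by
  obtain ⟨e₀, e₁, hU⟩ := exists_isometry_bdry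
  exact IsCompletelyIsometric.exists_quotient
    (e₀.toContinuousLinearEquiv.prodCongr e₁.toContinuousLinearEquiv) hU isClosed_hardy
    isClosed_hardyVanishing isCompletelyIsometric_quotEquiv

end OpSpace

end

open OpSpace in
theorem propositionA1 :
    -- `OH` is completely isometric to a quotient of a subspace of `R ⊕ C`
    (∃ (S : Submodule ℂ (Ell2 × Ell2)) (N : Submodule ℂ S) (φ : (S ⧸ N) ≃ₗ[ℂ] Ell2),
      IsClosed (S : Set (Ell2 × Ell2)) ∧ IsClosed (N : Set S) ∧
      IsCompletelyIsometric (quotientNorms (subNorms rowPlusCol S) N) ohNorms φ) ∧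
    -- `L₂(μ₀; ℓ₂)_r ⊕ L₂(μ₁; ℓ₂)_c` is completely isometric to `R ⊕ C`
    (∃ U : (L2left × L2right) ≃ₗ[ℂ] (Ell2 × Ell2),
      IsCompletelyIsometric bdryNorms rowPlusCol U) ∧
    -- every element of `G` has an analytic extension to the strip, and only one
    (∀ g ∈ hardy, ∃ f, IsAnalyticExtension f g ∧
      ∀ f', IsAnalyticExtension f' g → Set.EqOn f' f strip) ∧
    -- `f ↦ f (1 / 2)` induces a complete isometry of `G / N` onto `OH`
    (∃ φ : (hardy ⧸ hardyVanishing) ≃ₗ[ℂ] Ell2,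
      IsCompletelyIsometric (quotientNorms (subNorms bdryNorms hardy) hardyVanishing)
        ohNorms φ ∧
      ∀ (g : hardy) (f : ℂ → Ell2), IsAnalyticExtension f (g : L2left × L2right) →
        φ (hardyVanishing.mkQ g) = f (1 / 2)) := by
  refine ⟨exists_quotient_of_subspace, ?_, fun g hg => ?_, quotEquiv,
    isCompletelyIsometric_quotEquiv, fun g f h => ?_⟩
  · obtain ⟨e₀, e₁, hU⟩ := exists_isometry_bdry
    exact ⟨_, hU⟩
  · obtain ⟨f, hf⟩ := exists_isAnalyticExtension hg
    exact ⟨f, hf, fun f' hf' => hf.eqOn hf'⟩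
  · rw [quotEquiv_mkQ, evalHalf_eq h]
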